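/- Let $\mathbb{O}$ be the octonions with the standard basis $e_0=1,e_1,\dots,e_7$. An $\mathbb{O}$-bimodule is a real vector space $M$ with unital $\mathbb{R}$-bilinear left and right multiplications by $\mathbb{O}$ whose associators $[p,q,x]=(pq)x-p(qx)$, $[q,x,p]=(qx)p-q(xp)$, $[x,p,q]=(xp)q-x(pq)$ satisfy $[x,p,q]=-[x,q,p]$ and $[p,q,x]=[q,x,p]=[x,p,q]=-[q,p,x]$ for all $x\in M$, $p,q\in\mathbb{O}$. Put $\operatorname{Re}M=\{m\in M:[p,q,m]=0\ \forall p,q\in\mathbb{O}\}$, and let $\operatorname{Re}:M\to\operatorname{Re}M$ be the projection $\operatorname{Re}m=\frac5{12}m-\frac1{12}\sum_{i=1}^7e_ime_i$. A real-linear map $f$ between $\mathbb{O}$-bimodules is (right) para-linear if $\operatorname{Re}\bigl(f(x)p-f(xp)\bigr)=0$ for all $x$ and all $p\in\mathbb{O}$. A Hilbert $\mathbb{O}$-bimodule is an $\mathbb{O}$-bimodule $H$ with an $\mathbb{R}$-bilinear map $\langle\cdot,\cdot\rangle:H\times H\to\mathbb{O}$ such that every $\langle u,\cdot\rangle$ is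 para-linear, $\langle u,v\rangle=\overline{\langle v,u\rangle}$, and $\langle u,u\rangle$ is a nonnegative real number that vanishes only for $u=0$, and such that $H$ is complete for the norm $\|u\|=\sqrt{\langle u,u\rangle}$. The adjoint $T^*$ of a bounded real-linear operator $T$ on $H$ is the operator determined by $$\langle T^*y,x\rangle=\sum_{i=0}^7 \operatorname{Re}\langle y,T(x\overline{e_i})\rangle\,e_i\qquad(x,y\in H);$$ that is, $\langle T^*y,\cdot\rangle$ is the para-linear functional whose real part is $\operatorname{Re}\langle y,T(\cdot)\rangle$. $T$ is self-adjoint if $T=T^*$. The slice cone is $\mathbb{C}(H)=\bigcup_{J}(\operatorname{Re}H+J\operatorname{Re}H)$, where $J$ runs over the imaginary octonions with $|J|=1$. A strong eigenvector of $T$ with strong eigenvalue $\lambda\in\mathbb{O}$ is a nonzero $z\in\mathbb{C}(H)$ with $Tz=z\lambda$. For $z\in\mathbb{C}(H)$ put $P_z(x)=z\langle z,x\rangle$. $T$ has rank $n$ if $\operatorname{Ran}T$ is an $\mathbb{O}$-submodule of $H$ (a real subspace stable under left and right multiplication by $\mathbb{O}$) and $\dim_{\mathbb{R}}\operatorname{Re}(\operatorname{Ran}T)=n$.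 **Theorem.** Let $H$ be a Hilbert $\mathbb{O}$-bimodule and let $T$ be a bounded, self-adjoint, para-linear operator on $H$ of rank $n$. Let $z_1,\dots,z_n\in\mathbb{C}(H)$ be strong eigenvectors of $T$ with nonzero real eigenvalues $\lambda_1,\dots,\lambda_n$, such that $\|z_k\|=1$ for all $k$ and $\langle z_k,z_l\rangle=0$ for $k\neq l$. Then $$T=\sum_{k=1}^n\lambda_kP_{z_k}.$$ -/

import Mathlib

/-- The octonions: real coordinates with respect to the basis `1 = e₀, e₁, …, e₇`. -/
def Octonion : Type := Fin 8 → ℝ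

namespace Octonion

noncomputable section

instance : AddCommGroup Octonion := inferInstanceAs (AddCommGroup (Fin 8 → ℝ))
instance : Module ℝ Octonion := inferInstanceAs (Module ℝ (Fin 8 → ℝ))

/-- The basis `e₀, e₁, …, e₇`. -/
def e (i : Fin 8) : Octonion := (Pi.single i 1 : Fin 8 → ℝ)

/-- The real octonion `r`. -/
def ofReal (r : ℝ) : Octonion := (Pi.single 0 r : Fin 8 → ℝ)

instance : One Octonion := ⟨ofReal 1⟩

/-- The octonion product: `e₀ = 1`, and `eᵢ eⱼ = εᵢⱼₖ eₖ - δᵢⱼ` for `i, j ≥ 1`, where `ε` is totally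
antisymmetric with `εᵢⱼₖ = 1` on the triples (123), (145), (176), (246), (257), (347), (365). -/
instance : Mul Octonion := ⟨fun x y =>
  (![x 0 * y 0 - x 1 * y 1 - x 2 * y 2 - x 3 * y 3 - x 4 * y 4 - x 5 * y 5 - x 6 * y 6 - x 7 * y 7,
     x 0 * y 1 + x 1 * y 0 + x 2 * y 3 - x 3 * y 2 + x 4 * y 5 - x 5 * y 4 - x 6 * y 7 + x 7 * y 6,
     x 0 * y 2 - x 1 * y 3 + x 2 * y 0 + x 3 * y 1 + x 4 * y 6 + x 5 * y 7 - x 6 * y 4 - x 7 * y 5,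
     x 0 * y 3 + x 1 * y 2 - x 2 * y 1 + x 3 * y 0 + x 4 * y 7 - x 5 * y 6 + x 6 * y 5 - x 7 * y 4,
     x 0 * y 4 - x 1 * y 5 - x 2 * y 6 - x 3 * y 7 + x 4 * y 0 + x 5 * y 1 + x 6 * y 2 + x 7 * y 3,
     x 0 * y 5 + x 1 * y 4 - x 2 * y 7 + x 3 * y 6 - x 4 * y 1 + x 5 * y 0 - x 6 * y 3 + x 7 * y 2,
     x 0 * y 6 + x 1 * y 7 + x 2 * y 4 - x 3 * y 5 - x 4 * y 2 + x 5 * y 3 + x 6 * y 0 - x 7 * y 1,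
     x 0 * y 7 - x 1 * y 6 + x 2 * y 5 + x 3 * y 4 - x 4 * y 3 - x 5 * y 2 + x 6 * y 1 + x 7 * y 0
    ] : Fin 8 → ℝ)⟩

/-- Conjugation `x₀ + ∑ xᵢ eᵢ ↦ x₀ - ∑ xᵢ eᵢ`. -/
def conj (x : Octonion) : Octonion := fun i => if i = 0 then x i else - x i

/-- The real part of an octonion. -/
def re (x : Octonion) : ℝ := x 0

/-- The sphere `𝕊` of imaginary units: purely imaginary octonions of modulus one. -/
def imSphere : Set Octonion := {J | J.re = 0 ∧ ∑ i, J i ^ 2 = 1}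

end

end Octonion

/-- A (unital) bimodule over the octonions: a real vector space with `ℝ`-bilinear left and right
scalar multiplications `p x = lsmul p x` and `x p = rsmul x p`, whose left, middle and right
associators
`[p, q, x] = (p q) x - p (q x)`, `[q, x, p] = (q x) p - q (x p)`, `[x, p, q] = (x p) q - x (p q)`
satisfy `[x, p, q] = -[x, q, p]` and `[p, q, x] = [q, x, p] = [x, p, q] = -[q, p, x]`. -/
class OBimodule (M : Type*) [AddCommGroup M] [Module ℝ M] where
  lsmul : Octonion →ₗ[ℝ] M →ₗ[ℝ] M
  rsmul : M →ₗ[ℝ] Octonion →ₗ[ℝ] M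
  one_lsmul : ∀ x : M, lsmul 1 x = x
  rsmul_one : ∀ x : M, rsmul x 1 = x
  right_alternating : ∀ (x : M) (p q : Octonion),
    rsmul (rsmul x p) q - rsmul x (p * q) = -(rsmul (rsmul x q) p - rsmul x (q * p))
  left_eq_middle : ∀ (x : M) (p q : Octonion),
    lsmul (p * q) x - lsmul p (lsmul q x) = rsmul (lsmul q x) p - lsmul q (rsmul x p)
  middle_eq_right : ∀ (x : M) (p q : Octonion),
    rsmul (lsmul q x) p - lsmul q (rsmul x p) = rsmul (rsmul x p) q - rsmul x (p * q)
  right_eq_neg_left : ∀ (x : M) (p q : Octonion),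
    rsmul (rsmul x p) q - rsmul x (p * q) = -(lsmul (q * p) x - lsmul q (lsmul p x))

namespace OBimodule

noncomputable section

/-- The real part `Re M = {m : [p, q, m] = 0 for all p, q}` of an octonionic bimodule. -/
def realPart (M : Type*) [AddCommGroup M] [Module ℝ M] [OBimodule M] : Submodule ℝ M where
  carrier := {m | ∀ p q : Octonion, lsmul (p * q) m - lsmul p (lsmul q m) = 0}
  add_mem' := by
    intro a b ha hb p q
    have h := congrArg₂ (· + ·) (ha p q) (hb p q)
    simp only [map_add, add_zero] at h ⊢
    rw [← h]
    abel
  zero_mem' := by intro p q; simp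
  smul_mem' := by
    intro c a ha p q
    simp only [map_smul, ← smul_sub, ha p q, smul_zero]

/-- The projection `Re : M → Re M`, `Re m = (5/12) m - (1/12) ∑_{i=1}^7 eᵢ m eᵢ`. -/
def reProj {M : Type*} [AddCommGroup M] [Module ℝ M] [OBimodule M] (m : M) : M :=
  (5 / 12 : ℝ) • m -
    (1 / 12 : ℝ) • ∑ i : Fin 7, rsmul (lsmul (Octonion.e i.succ) m) (Octonion.e i.succ)

/-- The slice cone `ℂ(M) = ⋃_{J ∈ 𝕊} (Re M + J Re M)`. -/
def sliceCone (M : Type*) [AddCommGroup M] [Module ℝ M] [OBimodule M] : Set M :=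
  {z | ∃ J ∈ Octonion.imSphere, ∃ x ∈ realPart M, ∃ y ∈ realPart M, z = x + lsmul J y}

/-- A real-linear map `f : M → M` is right para-linear if the real part of its second right
associator `B_p(f, x) = f(x) p - f(x p)` vanishes for all `p` and `x`. -/
def IsParaLinear {M : Type*} [AddCommGroup M] [Module ℝ M] [OBimodule M]
    (f : M →ₗ[ℝ] M) : Prop :=
  ∀ (p : Octonion) (x : M), reProj (rsmul (f x) p - f (rsmul x p)) = 0

/-- A real subspace is an octonionic submodule if it is stable under both multiplications. -/
def IsOSubmodule {M : Type*} [AddCommGroup M] [Module ℝ M] [OBimodule M]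
    (N : Submodule ℝ M) : Prop :=
  ∀ (p : Octonion), ∀ x ∈ N, lsmul p x ∈ N ∧ rsmul x p ∈ N

/-- `f` has rank `n`: its range is an octonionic submodule `N` and
`dim_𝕆 N = dim_ℝ Re N = n`. -/
def HasRank {M : Type*} [AddCommGroup M] [Module ℝ M] [OBimodule M]
    (f : M →ₗ[ℝ] M) (n : ℕ) : Prop :=
  IsOSubmodule (LinearMap.range f) ∧
    Module.rank ℝ ↥(LinearMap.range f ⊓ realPart M) = (n : Cardinal)

/-- `z` is a strong eigenvector of `f` with strong eigenvalue `l`: a nonzero element of the slice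
cone with `f z = z l`. -/
def IsStrongEigenpair {M : Type*} [AddCommGroup M] [Module ℝ M] [OBimodule M]
    (f : M →ₗ[ℝ] M) (z : M) (l : Octonion) : Prop :=
  z ∈ sliceCone M ∧ z ≠ 0 ∧ f z = rsmul z l

end

end OBimodule

/-- A pre-Hilbert octonionic bimodule: an octonionic bimodule with an `ℝ`-bilinear octonion-valued
form `⟨u, v⟩ = oinner u v` such that each `⟨u, ·⟩` is right para-linear, `⟨u, v⟩` is the conjugate
of `⟨v, u⟩`, and `⟨u, u⟩` is a nonnegative real that vanishes only for `u = 0`. The last condition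
and the relation `‖u‖ = √⟨u, u⟩` are expressed together by `oinner_self`, as `‖·‖` is a norm.
A Hilbert octonionic bimodule is one that is complete, `[CompleteSpace H]`. -/
class PreHilbertOBimodule (H : Type*) [NormedAddCommGroup H] [NormedSpace ℝ H]
    extends OBimodule H where
  oinner : H →ₗ[ℝ] H →ₗ[ℝ] Octonion
  oinner_paraLinear : ∀ (u v : H) (p : Octonion),
    (oinner u v * p - oinner u (rsmul v p)).re = 0
  oinner_conj : ∀ u v : H, oinner u v = (oinner v u).conj
  oinner_self : ∀ u : H, oinner u u = Octonion.ofReal (‖u‖ ^ 2)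

namespace PreHilbertOBimodule

noncomputable section

open OBimodule

/-- The regular composition `f ⊚ g` of a right para-linear functional `f` with a real-linear map
`g`: the right para-linear functional whose real part is `Re f(g(x))`, given by
`(f ⊚ g)(x) = ∑_{i=0}^7 eᵢ Re f(g(x ēᵢ))`. -/
def regComp {H : Type*} [NormedAddCommGroup H] [NormedSpace ℝ H] [PreHilbertOBimodule H]
    (f : H →ₗ[ℝ] Octonion) (g : H →ₗ[ℝ] H) (x : H) : Octonion :=
  ∑ i : Fin 8, (f (g (rsmul x (Octonion.e i).conj))).re • Octonion.e i

/-- `S` is the adjoint `T*` of `T`: for every `y`, `S y` is the vector that represents the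
para-linear functional `⟨y, ·⟩ ⊚ T`, that is `⟨S y, x⟩ = (⟨y, ·⟩ ⊚ T)(x)` for all `x`. -/
def IsAdjoint {H : Type*} [NormedAddCommGroup H] [NormedSpace ℝ H] [PreHilbertOBimodule H]
    (T S : H →ₗ[ℝ] H) : Prop :=
  ∀ x y : H, oinner (S y) x = regComp (oinner y) T x

/-- `T` is self-adjoint: `T* = T`. -/
def IsSelfAdj {H : Type*} [NormedAddCommGroup H] [NormedSpace ℝ H] [PreHilbertOBimodule H]
    (T : H →ₗ[ℝ] H) : Prop :=
  IsAdjoint T T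

/-- The slice projection `P_z(x) = z ⟨z, x⟩`. -/
def sliceProj {H : Type*} [NormedAddCommGroup H] [NormedSpace ℝ H] [PreHilbertOBimodule H]
    (z : H) : H →ₗ[ℝ] H :=
  (rsmul z) ∘ₗ (oinner z)

end

end PreHilbertOBimodule

/-! The proof verifies the formula on `Re H` and extends it by right multiplication. The extension
needs the structure of bimodules: `M` is spanned over the octonions by `Re M`. The left
multiplications by `e₁, …, e₇` are anticommuting square roots of `-1`. Comparing left and right
associators forces the sign of their volume element, so the negated products `L_i L_j L_k` over the
seven Fano lines multiply like the nontrivial elements of `(ℤ/2)³`. Summing over this group produces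
real elements, and enough of them (`exists_eq_sum_lsmul`). Hence `m` is determined by the real parts
of all `m p`, and a para-linear `f` satisfies `f (x p) = f x p` whenever `(x p) q = x (p q)` for all
`q` (`IsParaLinear.map_rsmul`).

For `z = x + J y` in the slice cone and real `v`, the value `⟨z, v⟩` lies in `span (1, J)`, with
which `z` associates (`rsmul_rsmul_oinner`). So `T (z_k ⟨z_k, v⟩) = λ_k z_k ⟨z_k, v⟩`. Orthogonality
`⟨z, w⟩ = 0` in the slice cone passes to all `z p` and `w q` for the real inner product
(`re_oinner_rsmul_rsmul_eq_zero`). Therefore the `8 n` vectors `z_k e_i` form an orthonormal basis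
of `Ran T`, and `v = ∑ z_k ⟨z_k, v⟩` there (`eq_sum_rsmul_oinner`). This settles real `v` in `Ran
T`. A real `v` orthogonal to these satisfies `⟨v, Ran T⟩ = 0`, and self-adjointness gives `T v = 0`.
-/

namespace Octonion

/-! ### Octonion arithmetic in coordinates -/

theorem ext {x y : Octonion} (h : ∀ i, x i = y i) : x = y := funext h

theorem add_apply (x y : Octonion) (i : Fin 8) : (x + y) i = x i + y i := rfl
theorem sub_apply (x y : Octonion) (i : Fin 8) : (x - y) i = x i - y i := rfl
theorem neg_apply (x : Octonion) (i : Fin 8) : (-x) i = -x i := rfl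
theorem smul_apply (c : ℝ) (x : Octonion) (i : Fin 8) : (c • x) i = c * x i := rfl
theorem zero_apply (i : Fin 8) : (0 : Octonion) i = 0 := rfl

theorem sum_apply {ι : Type*} (s : Finset ι) (f : ι → Octonion) (i : Fin 8) :
    (∑ k ∈ s, f k) i = ∑ k ∈ s, f k i :=
  Finset.sum_apply i s (fun k => (f k : Fin 8 → ℝ))

theorem conj_apply (x : Octonion) (i : Fin 8) : x.conj i = if i = 0 then x i else - x i := rfl

theorem e_apply (i j : Fin 8) : e i j = if j = i then 1 else 0 := by
  simp [e, Pi.single_apply]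

theorem ofReal_apply (r : ℝ) (j : Fin 8) : ofReal r j = if j = 0 then r else 0 := by
  simp [ofReal, Pi.single_apply]

theorem one_apply (j : Fin 8) : (1 : Octonion) j = if j = 0 then 1 else 0 := ofReal_apply 1 j

theorem mul_apply_zero (x y : Octonion) : (x * y) 0 = x 0 * y 0 - x 1 * y 1 - x 2 * y 2
    - x 3 * y 3 - x 4 * y 4 - x 5 * y 5 - x 6 * y 6 - x 7 * y 7 := rfl
theorem mul_apply_one (x y : Octonion) : (x * y) 1 = x 0 * y 1 + x 1 * y 0 + x 2 * y 3
    - x 3 * y 2 + x 4 * y 5 - x 5 * y 4 - x 6 * y 7 + x 7 * y 6 := rfl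
theorem mul_apply_two (x y : Octonion) : (x * y) 2 = x 0 * y 2 - x 1 * y 3 + x 2 * y 0
    + x 3 * y 1 + x 4 * y 6 + x 5 * y 7 - x 6 * y 4 - x 7 * y 5 := rfl
theorem mul_apply_three (x y : Octonion) : (x * y) 3 = x 0 * y 3 + x 1 * y 2 - x 2 * y 1
    + x 3 * y 0 + x 4 * y 7 - x 5 * y 6 + x 6 * y 5 - x 7 * y 4 := rfl
theorem mul_apply_four (x y : Octonion) : (x * y) 4 = x 0 * y 4 - x 1 * y 5 - x 2 * y 6
    - x 3 * y 7 + x 4 * y 0 + x 5 * y 1 + x 6 * y 2 + x 7 * y 3 := rfl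
theorem mul_apply_five (x y : Octonion) : (x * y) 5 = x 0 * y 5 + x 1 * y 4 - x 2 * y 7
    + x 3 * y 6 - x 4 * y 1 + x 5 * y 0 - x 6 * y 3 + x 7 * y 2 := rfl
theorem mul_apply_six (x y : Octonion) : (x * y) 6 = x 0 * y 6 + x 1 * y 7 + x 2 * y 4
    - x 3 * y 5 - x 4 * y 2 + x 5 * y 3 + x 6 * y 0 - x 7 * y 1 := rfl
theorem mul_apply_seven (x y : Octonion) : (x * y) 7 = x 0 * y 7 - x 1 * y 6 + x 2 * y 5
    + x 3 * y 4 - x 4 * y 3 - x 5 * y 2 + x 6 * y 1 + x 7 * y 0 := rfl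

theorem ext_coords {x y : Octonion} (h0 : x 0 = y 0) (h1 : x 1 = y 1) (h2 : x 2 = y 2)
    (h3 : x 3 = y 3) (h4 : x 4 = y 4) (h5 : x 5 = y 5) (h6 : x 6 = y 6) (h7 : x 7 = y 7) :
    x = y := by
  refine ext fun i => ?_
  fin_cases i <;> assumption

scoped instance : NonAssocRing Octonion :=
  { (inferInstance : AddCommGroup Octonion), (inferInstance : Mul Octonion),
    (inferInstance : One Octonion) with
    left_distrib := fun x y z => by
      apply ext_coords <;> simp only [mul_apply_zero, mul_apply_one, mul_apply_two,
        mul_apply_three, mul_apply_four, mul_apply_five, mul_apply_six, mul_apply_seven,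
        add_apply] <;> ring
    right_distrib := fun x y z => by
      apply ext_coords <;> simp only [mul_apply_zero, mul_apply_one, mul_apply_two,
        mul_apply_three, mul_apply_four, mul_apply_five, mul_apply_six, mul_apply_seven,
        add_apply] <;> ring
    zero_mul := fun x => by
      apply ext_coords <;> simp [mul_apply_zero, mul_apply_one, mul_apply_two,
        mul_apply_three, mul_apply_four, mul_apply_five, mul_apply_six, mul_apply_seven,
        zero_apply]
    mul_zero := fun x => by
      apply ext_coords <;> simp [mul_apply_zero, mul_apply_one, mul_apply_two,
        mul_apply_three, mul_apply_four, mul_apply_five, mul_apply_six, mul_apply_seven,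
        zero_apply]
    one_mul := fun x => by
      apply ext_coords <;> simp [mul_apply_zero, mul_apply_one, mul_apply_two,
        mul_apply_three, mul_apply_four, mul_apply_five, mul_apply_six, mul_apply_seven,
        one_apply]
    mul_one := fun x => by
      apply ext_coords <;> simp [mul_apply_zero, mul_apply_one, mul_apply_two,
        mul_apply_three, mul_apply_four, mul_apply_five, mul_apply_six, mul_apply_seven,
        one_apply] }

scoped instance : IsScalarTower ℝ Octonion Octonion :=
  ⟨fun c x y => by
    simp only [smul_eq_mul]
    apply ext_coords <;> simp only [mul_apply_zero, mul_apply_one, mul_apply_two,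
      mul_apply_three, mul_apply_four, mul_apply_five, mul_apply_six, mul_apply_seven,
      smul_apply] <;> ring⟩

scoped instance : SMulCommClass ℝ Octonion Octonion :=
  ⟨fun c x y => by
    simp only [smul_eq_mul]
    apply ext_coords <;> simp only [mul_apply_zero, mul_apply_one, mul_apply_two,
      mul_apply_three, mul_apply_four, mul_apply_five, mul_apply_six, mul_apply_seven,
      smul_apply] <;> ring⟩

theorem re_add (x y : Octonion) : (x + y).re = x.re + y.re := rfl
theorem re_sub (x y : Octonion) : (x - y).re = x.re - y.re := rfl
theorem re_smul (c : ℝ) (x : Octonion) : (c • x).re = c * x.re := rfl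
theorem re_zero : (0 : Octonion).re = 0 := rfl
theorem re_conj (x : Octonion) : x.conj.re = x.re := rfl

theorem re_sum {ι : Type*} (s : Finset ι) (f : ι → Octonion) :
    (∑ k ∈ s, f k).re = ∑ k ∈ s, (f k).re := sum_apply s f 0

theorem ofReal_eq_smul (r : ℝ) : ofReal r = r • (1 : Octonion) := by
  refine ext fun i => ?_
  rw [smul_apply, one_apply, ofReal_apply]
  split_ifs <;> simp

theorem e_zero : e 0 = 1 := rfl

theorem conj_conj (x : Octonion) : x.conj.conj = x := by
  refine ext fun i => ?_
  simp only [conj_apply]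
  split_ifs <;> simp

theorem conj_one : (1 : Octonion).conj = 1 := by
  refine ext fun i => ?_
  simp only [conj_apply, one_apply]
  split_ifs <;> simp

theorem conj_eq (x : Octonion) : x.conj = (2 * x.re) • (1 : Octonion) - x := by
  refine ext fun i => ?_
  simp only [conj_apply, sub_apply, smul_apply, one_apply, re]
  split_ifs with h
  · subst h; ring
  · ring

theorem conj_mul (x y : Octonion) : (x * y).conj = y.conj * x.conj := by
  apply ext_coords <;> simp [mul_apply_zero, mul_apply_one, mul_apply_two,
    mul_apply_three, mul_apply_four, mul_apply_five, mul_apply_six, mul_apply_seven,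
    conj_apply] <;> ring

theorem re_mul_comm (x y : Octonion) : (x * y).re = (y * x).re := by
  simp only [re, mul_apply_zero]; ring

theorem re_mul_assoc (x y z : Octonion) : (x * y * z).re = (x * (y * z)).re := by
  simp only [re, mul_apply_zero, mul_apply_one, mul_apply_two,
    mul_apply_three, mul_apply_four, mul_apply_five, mul_apply_six, mul_apply_seven]; ring

theorem mul_mul_self_left (x y : Octonion) : x * (x * y) = x * x * y := by
  apply ext_coords <;> simp only [mul_apply_zero, mul_apply_one, mul_apply_two,
    mul_apply_three, mul_apply_four, mul_apply_five, mul_apply_six, mul_apply_seven] <;> ring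

/-- An octonion is the sum of its coordinates, read off by real parts. -/
theorem eq_sum (x : Octonion) : x = ∑ i, (x * (e i).conj).re • e i := by
  refine ext fun j => ?_
  rw [sum_apply]
  have h : ∀ i, (x * (e i).conj).re = x i := by
    intro i
    fin_cases i <;> simp [re, mul_apply_zero, conj_apply, e_apply]
  fin_cases j <;> simp [h, smul_apply, e_apply, Fin.sum_univ_eight]

/-- Para-linearity controls only real parts; this nondegeneracy turns such information into
equalities of octonions. -/
theorem ext_re_mul {x y : Octonion} (h : ∀ p, (x * p).re = (y * p).re) : x = y := by
  rw [eq_sum x, eq_sum y]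
  exact Finset.sum_congr rfl fun i _ => by rw [h]

theorem eq_sum_apply (x : Octonion) : x = ∑ i, x i • e i := by
  refine ext fun j => ?_
  rw [sum_apply]
  fin_cases j <;> simp [smul_apply, e_apply, Fin.sum_univ_eight]

/-- The nucleus of the octonions is the real line. -/
theorem eq_ofReal_of_middle_assoc {c : Octonion} (h : ∀ p q : Octonion, q * c * p = q * (c * p)) :
    c = ofReal c.re := by
  -- An associator with two basis units detects the components of `c` off their Fano line: the pair
  -- `e₁, e₂` kills `c₄, …, c₇`, the pair `e₄, e₅` kills `c₂, c₃`, and `e₄, e₆` kills `c₁`.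
  have h1 := congrArg (fun x : Octonion => (x 5, x 6, x 7, x 4)) (h (e 1) (e 2))
  have h2 := congrArg (fun x : Octonion => (x 1, x 2, x 3)) (h (e 4) (e 5))
  have h3 := congrArg (fun x : Octonion => (x 1, x 2, x 3)) (h (e 4) (e 6))
  simp [mul_apply_zero, mul_apply_one, mul_apply_two, mul_apply_three, mul_apply_four,
    mul_apply_five, mul_apply_six, mul_apply_seven, e_apply] at h1 h2 h3
  apply ext_coords <;> simp [ofReal_apply, re] <;> grind

theorem mul_self_of_mem_imSphere {J : Octonion} (hJ : J ∈ imSphere) : J * J = -1 := by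
  obtain ⟨h0, h1⟩ := hJ
  have h0' : J 0 = 0 := h0
  simp only [Fin.sum_univ_eight, h0'] at h1
  apply ext_coords <;> simp [mul_apply_zero, mul_apply_one, mul_apply_two,
    mul_apply_three, mul_apply_four, mul_apply_five, mul_apply_six, mul_apply_seven,
    h0', neg_apply, one_apply] <;> linarith

theorem conj_of_mem_imSphere {J : Octonion} (hJ : J ∈ imSphere) : J.conj = -J := by
  rw [conj_eq, hJ.1]; simp

/-- If `1, J, K, J K` satisfy a linear relation that involves `J K`, then `J, K, q` associate. -/
theorem smul_assoc_eq_zero {J K : Octonion} (hJ : J ∈ imSphere) {α β γ δ : ℝ}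
    (h : α • (1 : Octonion) + β • K - γ • J - δ • (J * K) = 0) (q : Octonion) :
    δ • (J * K * q - J * (K * q)) = 0 := by
  by_cases hδ : δ = 0
  · simp [hδ]
  have hJJ := mul_self_of_mem_imSphere hJ
  have hJK : δ • (J * K) = α • (1 : Octonion) + β • K - γ • J := by
    rw [← sub_eq_zero, ← neg_eq_zero, ← h]; abel
  have h2 : δ • (J * (J * K)) = α • J + β • (J * K) + γ • (1 : Octonion) := by
    rw [← mul_smul_comm, hJK]
    simp only [mul_add, mul_sub, mul_smul_comm, mul_one, hJJ]
    module
  rw [mul_mul_self_left, hJJ, neg_one_mul] at h2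
  -- Multiplying the relation by `J` and eliminating `J K` puts `K` in `span (1, J)`; the associator
  -- then vanishes by alternativity.
  have h3 : (δ ^ 2 + β ^ 2) • K = -((δ * α - β * γ) • J + (β * α + δ * γ) • (1 : Octonion)) := by
    have h4 : δ • (δ • -K) = (δ * α) • J + β • (δ • (J * K)) + (δ * γ) • (1 : Octonion) := by
      rw [h2]; module
    rw [hJK] at h4
    have h5 : (δ ^ 2 + β ^ 2) • K = -(δ • (δ • -K)) + β ^ 2 • K := by module
    rw [h5, h4]; module
  have h4 : (δ ^ 2 + β ^ 2) • (J * K * q - J * (K * q)) = 0 := by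
    have : (δ ^ 2 + β ^ 2) • (J * K * q - J * (K * q))
        = J * ((δ ^ 2 + β ^ 2) • K) * q - J * (((δ ^ 2 + β ^ 2) • K) * q) := by
      simp only [mul_smul_comm, smul_mul_assoc, smul_sub]
    rw [this, h3]
    simp only [mul_neg, neg_mul, mul_add, add_mul, mul_smul_comm, smul_mul_assoc, mul_one,
      one_mul, mul_mul_self_left]
    abel
  have h5 : δ ^ 2 + β ^ 2 ≠ 0 := by positivity
  rw [(smul_eq_zero.mp h4).resolve_left h5, smul_zero]

theorem re_smul_mul_conj (p q : Octonion) : (q * p.conj).re = ∑ i, p i * q i := by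
  simp [re, mul_apply_zero, conj_apply, Fin.sum_univ_eight]; ring

/-- Every basis imaginary unit is a multiple of an associator. -/
theorem exists_e_eq_associator (i : Fin 8) (hi : i ≠ 0) :
    ∃ x y z : Octonion, e i = x * y * z - x * (y * z) := by
  -- Three units not on a common Fano line have associator `±2` times a unit, whence the factors
  -- `±1/2`.
  have key : ∃ (c : ℝ) (a b d : Fin 8), e i = c • (e a * e b * e d - e a * (e b * e d)) := by
    fin_cases i
    · exact absurd rfl hi
    refine ⟨-1 / 2, 2, 4, 7, ?_⟩; rotate_left
    refine ⟨1 / 2, 1, 4, 7, ?_⟩; rotate_left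
    refine ⟨-1 / 2, 1, 4, 6, ?_⟩; rotate_left
    refine ⟨-1 / 2, 1, 2, 7, ?_⟩; rotate_left
    refine ⟨1 / 2, 1, 2, 6, ?_⟩; rotate_left
    refine ⟨-1 / 2, 1, 2, 5, ?_⟩; rotate_left
    refine ⟨1 / 2, 1, 2, 4, ?_⟩; rotate_left
    all_goals
      apply ext_coords <;> simp [mul_apply_zero, mul_apply_one, mul_apply_two, mul_apply_three,
        mul_apply_four, mul_apply_five, mul_apply_six, mul_apply_seven, e_apply, smul_apply,
        sub_apply]; norm_num
  obtain ⟨c, a, b, d, h⟩ := key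
  refine ⟨c • e a, e b, e d, ?_⟩
  simp only [h, smul_mul_assoc, smul_sub]

theorem e_mul_self (i : Fin 8) (hi : i ≠ 0) : e i * e i = -1 := by
  fin_cases i
  · exact absurd rfl hi
  all_goals apply ext_coords <;> simp [mul_apply_zero, mul_apply_one, mul_apply_two,
      mul_apply_three, mul_apply_four, mul_apply_five, mul_apply_six, mul_apply_seven, e_apply,
      neg_apply, one_apply]

theorem neg_mul_of_ne {i j : Fin 8} (hi : i ≠ 0) (hj : j ≠ 0) (hij : i ≠ j) :
    e j * e i = -(e i * e j) := by
  fin_cases i <;> fin_cases j <;> first | exact absurd rfl ‹_› | skip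
  all_goals apply ext_coords <;> simp [mul_apply_zero, mul_apply_one, mul_apply_two,
      mul_apply_three, mul_apply_four, mul_apply_five, mul_apply_six, mul_apply_seven, e_apply,
      neg_apply]

end Octonion

/-! ### Anticommuting square roots of `-1` -/

section Clifford

variable {A : Type*} [Ring A] [Algebra ℝ A]

theorem eq_zero_of_add_self_eq_zero {x : A} (h : x + x = 0) : x = 0 := by
  rw [← two_smul ℝ x] at h
  exact (smul_eq_zero.mp h).resolve_left two_ne_zero

/-- Two anticommuting triples of square roots of `-1` whose associators agree: the sum of the
third members is reversed by the product of the first triple. -/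
theorem add_mul_triple {li lj lk ri rj rk : A}
    (hi : li * li = -1) (hj : lj * lj = -1) (hk : lk * lk = -1)
    (hij : lj * li = -(li * lj)) (hik : lk * li = -(li * lk)) (hjk : lk * lj = -(lj * lk))
    (ri2 : ri * ri = -1) (rj2 : rj * rj = -1) (rk2 : rk * rk = -1)
    (rij : rj * ri = -(ri * rj)) (rik : rk * ri = -(ri * rk)) (rjk : rk * rj = -(rj * rk))
    (hD : lk - li * lj = rj * ri - rk) :
    (lk + rk) * (li * lj * lk) = -(lk + rk) := by
  have hij' : ∀ x, lj * (li * x) = -(li * (lj * x)) := fun x => by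
    rw [← mul_assoc, hij, neg_mul, mul_assoc]
  have hik' : ∀ x, lk * (li * x) = -(li * (lk * x)) := fun x => by
    rw [← mul_assoc, hik, neg_mul, mul_assoc]
  have hjk' : ∀ x, lk * (lj * x) = -(lj * (lk * x)) := fun x => by
    rw [← mul_assoc, hjk, neg_mul, mul_assoc]
  have sk' : ∀ x, rk * (rk * x) = -x := fun x => by rw [← mul_assoc, rk2, neg_one_mul]
  have sij' : ∀ x, rj * (ri * x) = -(ri * (rj * x)) := fun x => by
    rw [← mul_assoc, rij, neg_mul, mul_assoc]
  have sik' : ∀ x, rk * (ri * x) = -(ri * (rk * x)) := fun x => by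
    rw [← mul_assoc, rik, neg_mul, mul_assoc]
  -- Squaring the two sides of `hD` yields `-2 (1 + li lj lk)` and `-2 (1 + rk rj ri)`, so the two
  -- triple products agree.
  have hA : (lk - li * lj) * (lk - li * lj) = -(1 + li * lj * lk + (1 + li * lj * lk)) := by
    simp only [mul_sub, sub_mul, mul_assoc, hi, hj, hk, hjk, hij', hik', mul_neg, neg_neg, mul_one]
    abel
  have hB : (rj * ri - rk) * (rj * ri - rk) = -(1 + rk * rj * ri + (1 + rk * rj * ri)) := by
    simp only [mul_sub, sub_mul, mul_assoc, ri2, rj2, rk2, rij, rik, rjk, sij', sik', mul_neg,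
      neg_mul, neg_neg, mul_one]
    abel
  have hAB : li * lj * lk = rk * rj * ri := by
    rw [hD, hB] at hA
    rw [← sub_eq_zero]
    apply eq_zero_of_add_self_eq_zero
    have := neg_injective hA
    rw [← sub_eq_zero] at this
    rw [← neg_eq_zero, ← this]
    abel
  have h1 : lk * (li * lj * lk) = -(li * lj) := by
    simp only [mul_assoc, hk, hik', hjk', mul_neg, neg_neg, mul_one]
  have h2 : rk * (rk * rj * ri) = -(rj * ri) := by
    simp only [mul_assoc, sk']
  rw [add_mul, h1, hAB, h2]
  have : rj * ri = lk - li * lj + rk := by rw [hD]; abel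
  rw [this]; abel

/-- Three triples through the common member `l 0` in a system of seven anticommuting square roots
of `-1`. -/
theorem triple_mul_triple {l : Fin 7 → A} {r : A} (hsq : ∀ i, l i * l i = -1)
    (hac : ∀ i j, i < j → l j * l i = -(l i * l j))
    (h1 : (l 0 + r) * (l 1 * l 2 * l 0) = -(l 0 + r))
    (h2 : (l 0 + r) * (l 3 * l 4 * l 0) = -(l 0 + r))
    (h3 : (l 0 + r) * (l 5 * l 6 * l 0) = -(l 0 + r))
    (hD : l 2 - l 0 * l 1 = r * l 1 - l 1 * r) :
    (l 1 * l 2 * l 0) * (l 3 * l 4 * l 0) = -(l 5 * l 6 * l 0) := by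
  have hsq' : ∀ i x, l i * (l i * x) = -x := fun i x => by rw [← mul_assoc, hsq, neg_one_mul]
  have hac' : ∀ i j x, i < j → l j * (l i * x) = -(l i * (l j * x)) := fun i j x h => by
    rw [← mul_assoc, hac i j h, neg_mul, mul_assoc]
  -- Up to sign `w` is the volume element of the seven generators, so it commutes with each of them.
  -- The aim is `w = -1`.
  set w := l 1 * l 2 * l 0 * (l 3 * l 4 * l 0) * (l 5 * l 6 * l 0) with hw
  have hFw : (l 0 + r) * w = -(l 0 + r) := by
    rw [hw, ← mul_assoc _ _ (l 5 * l 6 * l 0), ← mul_assoc _ _ (l 3 * l 4 * l 0), h1, neg_mul, h2,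
      neg_neg, h3]
  have hwc : ∀ i, l i * w = w * l i := by
    intro i
    rw [hw]
    fin_cases i <;> simp [mul_assoc, hsq, hsq', hac, hac']
  have hww : w * w = 1 := by
    rw [hw]
    simp [mul_assoc, hsq, hsq', hac, hac']
  -- After right multiplication by `1 + w`, the operator `r` acts as `-l 0`; this turns `hD` into `l
  -- 2 = -l 0 * l 1` there.
  have hrP : r * (1 + w) = -(l 0 * (1 + w)) := by
    have : (l 0 + r) * (1 + w) = 0 := by rw [mul_add, hFw, mul_one]; abel
    rw [add_mul] at this
    rw [eq_neg_iff_add_eq_zero, add_comm]; exact this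
  have hcP : ∀ i, l i * (1 + w) = (1 + w) * l i := fun i => by
    rw [mul_add, add_mul, hwc, mul_one, one_mul]
  have hb : l 2 * (1 + w) = -(l 0 * (l 1 * (1 + w))) := by
    have h4 := congrArg (· * (1 + w)) hD
    simp only [sub_mul, mul_assoc] at h4
    rw [hcP 1, ← mul_assoc r, hrP, neg_mul, mul_assoc, ← hcP 1, mul_neg, ← mul_assoc (l 1),
      hac 0 1 (by decide), neg_mul, mul_assoc] at h4
    have h5 : l 2 * (1 + w) = (l 2 * (1 + w) - l 0 * (l 1 * (1 + w))) + l 0 * (l 1 * (1 + w)) := by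
      abel
    rw [h5, h4]; abel
  -- Sandwiching between two copies of `l 3`, which lies outside the triple, preserves `l 2` but
  -- reverses the sign of `l 0 * l 1`. The two relations together kill `1 + w`.
  have hb' : l 2 * (1 + w) = l 0 * (l 1 * (1 + w)) := by
    have h4 := congrArg (fun x => l 3 * (x * l 3)) hb
    simp only [mul_assoc, neg_mul, ← hcP 3] at h4
    generalize 1 + w = P at h4
    simpa [hac', hsq'] using h4
  have hP : 1 + w = 0 := by
    have h4 : l 2 * (1 + w) = 0 := by
      apply eq_zero_of_add_self_eq_zero
      nth_rewrite 1 [hb]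
      rw [hb', neg_add_cancel]
    rw [← neg_eq_zero, ← hsq' 2, h4, mul_zero]
  have hw1 : w = -1 := by rw [eq_neg_iff_add_eq_zero, add_comm]; exact hP
  have h33 : (l 5 * l 6 * l 0) * (l 5 * l 6 * l 0) = 1 := by
    simp [mul_assoc, hsq, hac, hac']
  calc l 1 * l 2 * l 0 * (l 3 * l 4 * l 0)
      = w * (l 5 * l 6 * l 0) := by rw [hw, mul_assoc _ (l 5 * l 6 * l 0), h33, mul_one]
    _ = _ := by rw [hw1, neg_one_mul]

end Clifford

/-! ### The Fano plane -/

namespace Octonion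

/-- First members of the seven triples that define the octonion product. -/
def lineFst : Fin 7 → Fin 8 := ![1, 1, 1, 2, 2, 3, 3]
/-- Second members of the seven triples that define the octonion product. -/
def lineSnd : Fin 7 → Fin 8 := ![2, 4, 7, 4, 5, 4, 6]
/-- Third members of the seven triples that define the octonion product. -/
def lineTrd : Fin 7 → Fin 8 := ![3, 5, 6, 6, 7, 7, 5]

theorem e_mul_line (t : Fin 7) :
    e (lineFst t) * e (lineSnd t) = e (lineTrd t) ∧
    e (lineSnd t) * e (lineTrd t) = e (lineFst t) ∧
    e (lineTrd t) * e (lineFst t) = e (lineSnd t) := by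
  fin_cases t <;> refine ⟨?_, ?_, ?_⟩ <;> apply ext_coords <;>
    simp [lineFst, lineSnd, lineTrd, mul_apply_zero, mul_apply_one, mul_apply_two, mul_apply_three,
      mul_apply_four, mul_apply_five, mul_apply_six, mul_apply_seven, e_apply]

theorem line_ne (t : Fin 7) : lineFst t ≠ 0 ∧ lineSnd t ≠ 0 ∧ lineTrd t ≠ 0 ∧
    lineFst t ≠ lineSnd t ∧ lineFst t ≠ lineTrd t ∧ lineSnd t ≠ lineTrd t := by
  revert t; decide

theorem exists_line (i j : Fin 8) : i = 0 ∨ j = 0 ∨ i = j ∨ ∃ t : Fin 7,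
    (i = lineFst t ∧ j = lineSnd t) ∨ (i = lineSnd t ∧ j = lineTrd t) ∨
    (i = lineTrd t ∧ j = lineFst t) ∨ (j = lineFst t ∧ i = lineSnd t) ∨
    (j = lineSnd t ∧ i = lineTrd t) ∨ (j = lineTrd t ∧ i = lineFst t) := by
  revert i j; decide

end Octonion

/-! ### Left and right multiplications by the basis units -/

namespace OBimodule

open Octonion

variable {M : Type*} [AddCommGroup M] [Module ℝ M] [OBimodule M]

theorem left_eq_right (x : M) (p q : Octonion) :
    lsmul (p * q) x - lsmul p (lsmul q x) = rsmul (rsmul x p) q - rsmul x (p * q) :=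
  (left_eq_middle x p q).trans (middle_eq_right x p q)

theorem left_alternating (x : M) (p q : Octonion) :
    lsmul (p * q) x - lsmul p (lsmul q x) = -(lsmul (q * p) x - lsmul q (lsmul p x)) :=
  (left_eq_right x p q).trans (right_eq_neg_left x p q)

theorem lsmul_lsmul_self (x : M) (p : Octonion) : lsmul p (lsmul p x) = lsmul (p * p) x := by
  have h := left_alternating x p p
  have h2 : (2 : ℝ) • (lsmul (p * p) x - lsmul p (lsmul p x)) = 0 := by
    rw [two_smul]; nth_rewrite 1 [h]; exact neg_add_cancel _
  exact (sub_eq_zero.mp ((smul_eq_zero.mp h2).resolve_left two_ne_zero)).symm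

theorem rsmul_rsmul_self (x : M) (p : Octonion) : rsmul (rsmul x p) p = rsmul x (p * p) := by
  rw [← sub_eq_zero, ← left_eq_right, lsmul_lsmul_self, sub_self]

variable (M) in
/-- Left multiplication by the `i`-th basis octonion. -/
def lE (i : Fin 8) : Module.End ℝ M := lsmul (e i)

variable (M) in
/-- Right multiplication by the `i`-th basis octonion. -/
def rE (i : Fin 8) : Module.End ℝ M := (rsmul (M := M)).flip (e i)

theorem lE_apply (i : Fin 8) (x : M) : lE M i x = lsmul (e i) x := rfl

theorem rE_apply (i : Fin 8) (x : M) : rE M i x = rsmul x (e i) := rfl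

theorem lE_mul_self {i : Fin 8} (hi : i ≠ 0) : lE M i * lE M i = -1 := by
  ext x
  simp [lE_apply, lsmul_lsmul_self, e_mul_self i hi, one_lsmul]

theorem rE_mul_self {i : Fin 8} (hi : i ≠ 0) : rE M i * rE M i = -1 := by
  ext x
  simp [rE_apply, rsmul_rsmul_self, e_mul_self i hi, rsmul_one]

theorem lE_anticomm {i j : Fin 8} (hi : i ≠ 0) (hj : j ≠ 0) (hij : i ≠ j) :
    lE M j * lE M i = -(lE M i * lE M j) := by
  ext x
  have h := left_alternating x (e i) (e j)
  rw [neg_mul_of_ne hi hj hij, map_neg, LinearMap.neg_apply] at h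
  simp only [Module.End.mul_apply, LinearMap.neg_apply, lE_apply]
  rw [eq_neg_iff_add_eq_zero, ← neg_eq_zero]
  have h' := sub_eq_zero.mpr h
  rw [← h']
  abel

theorem rE_anticomm {i j : Fin 8} (hi : i ≠ 0) (hj : j ≠ 0) (hij : i ≠ j) :
    rE M j * rE M i = -(rE M i * rE M j) := by
  ext x
  have h := right_alternating x (e i) (e j)
  rw [neg_mul_of_ne hi hj hij, map_neg] at h
  simp only [Module.End.mul_apply, LinearMap.neg_apply, rE_apply]
  rw [eq_neg_iff_add_eq_zero]
  have h' := sub_eq_zero.mpr h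
  rw [← h']
  abel

/-- This and the next comparison of associators tie the left multiplications to the right ones; they
are the hypotheses `hD` of the Clifford lemmas. -/
theorem lE_sub_eq_middle {i j k : Fin 8} (h : e i * e j = e k) :
    lE M k - lE M i * lE M j = rE M i * lE M j - lE M j * rE M i := by
  ext x
  have := left_eq_middle x (e i) (e j)
  rw [h] at this
  exact this

theorem lE_sub_eq_right {i j k : Fin 8} (h : e i * e j = e k) :
    lE M k - lE M i * lE M j = rE M j * rE M i - rE M k := by
  ext x
  have := left_eq_right x (e i) (e j)
  rw [h] at this
  exact this

theorem lE_add_rE_mul {i j k : Fin 8} (hi : i ≠ 0) (hj : j ≠ 0) (hk : k ≠ 0) (hij : i ≠ j)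
    (hik : i ≠ k) (hjk : j ≠ k) (h : e i * e j = e k) :
    (lE M k + rE M k) * (lE M i * lE M j * lE M k) = -(lE M k + rE M k) :=
  add_mul_triple (lE_mul_self hi) (lE_mul_self hj) (lE_mul_self hk) (lE_anticomm hi hj hij)
    (lE_anticomm hi hk hik) (lE_anticomm hj hk hjk) (rE_mul_self hi) (rE_mul_self hj)
    (rE_mul_self hk) (rE_anticomm hi hj hij) (rE_anticomm hi hk hik) (rE_anticomm hj hk hjk)
    (lE_sub_eq_right h)

theorem lE_rotate {i j k : Fin 8} (hi : i ≠ 0) (hj : j ≠ 0) (hk : k ≠ 0) (hij : i ≠ j)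
    (hik : i ≠ k) : lE M j * lE M k * lE M i = lE M i * lE M j * lE M k := by
  rw [mul_assoc, lE_anticomm hi hk hik, mul_neg, ← mul_assoc, lE_anticomm hi hj hij, neg_mul,
    neg_neg]

variable (M) in
/-- The product of the left multiplications by the members of a triple. -/
def lineOp (t : Fin 7) : Module.End ℝ M := lE M (lineFst t) * lE M (lineSnd t) * lE M (lineTrd t)

theorem lineOp_mul_self (t : Fin 7) : lineOp M t * lineOp M t = 1 := by
  obtain ⟨h1, h2, h3, h12, h13, h23⟩ := line_ne t
  have h (i j : Fin 8) (hi : i ≠ 0) (hj : j ≠ 0) (hij : i ≠ j) (x : Module.End ℝ M) :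
      lE M j * (lE M i * x) = -(lE M i * (lE M j * x)) := by
    rw [← mul_assoc, lE_anticomm hi hj hij, neg_mul, mul_assoc]
  have h' (i : Fin 8) (hi : i ≠ 0) (x : Module.End ℝ M) : lE M i * (lE M i * x) = -x := by
    rw [← mul_assoc, lE_mul_self hi, neg_one_mul]
  simp only [lineOp, mul_assoc]
  rw [h _ _ h1 h3 h13, mul_neg, mul_neg, h _ _ h1 h2 h12, mul_neg, h' _ h1, neg_neg,
    h _ _ h2 h3 h23, mul_neg, h' _ h2, neg_neg, lE_mul_self h3, neg_neg]

/-- The product of the operators of two triples is minus the operator of the third triple through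
their common member. -/
theorem line_mul_line {k a b c d f g : Fin 8} (hnd : [0, k, a, b, c, d, f, g].Nodup)
    (h1 : e a * e b = e k) (h2 : e c * e d = e k) (h3 : e f * e g = e k) (h4 : e k * e a = e b) :
    lE M a * lE M b * lE M k * (lE M c * lE M d * lE M k) = -(lE M f * lE M g * lE M k) := by
  simp only [List.nodup_cons, List.mem_cons, List.not_mem_nil, not_or, not_false_eq_true, or_false,
    List.nodup_nil, and_true] at hnd
  obtain ⟨⟨k0, a0, b0, c0, d0, f0, g0⟩, ⟨ka, kb, kc, kd, kf, kg⟩, ⟨ab, ac, ad, af, ag⟩,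
    ⟨bc, bd, bf, bg⟩, ⟨cd, cf, cg⟩, ⟨df, dg⟩, fg⟩ := hnd
  refine triple_mul_triple (l := ![lE M k, lE M a, lE M b, lE M c, lE M d, lE M f, lE M g])
    (r := rE M k) ?_ ?_
    (lE_add_rE_mul (Ne.symm a0) (Ne.symm b0) (Ne.symm k0) ab (Ne.symm ka) (Ne.symm kb) h1)
    (lE_add_rE_mul (Ne.symm c0) (Ne.symm d0) (Ne.symm k0) cd (Ne.symm kc) (Ne.symm kd) h2)
    (lE_add_rE_mul (Ne.symm f0) (Ne.symm g0) (Ne.symm k0) fg (Ne.symm kf) (Ne.symm kg) h3)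
    (lE_sub_eq_middle h4)
  · simp only [Fin.forall_fin_succ, IsEmpty.forall_iff, and_true]
    refine ⟨?_, ?_, ?_, ?_, ?_, ?_, ?_⟩ <;> exact lE_mul_self (Ne.symm ‹_›)
  · have key : ∀ {i j : Fin 8}, ¬ (0 = i) → ¬ (0 = j) → ¬ (i = j) →
        lE M j * lE M i = -(lE M i * lE M j) :=
      fun hi hj hij => lE_anticomm (Ne.symm hi) (Ne.symm hj) hij
    intro i j hij
    fin_cases i <;> fin_cases j <;>
      first | exact absurd hij (by decide) | exact key ‹_› ‹_› ‹_›

end OBimodule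

/-! ### The multiplication table of the seven triple operators -/

namespace OBimodule

open Octonion

variable {M : Type*} [AddCommGroup M] [Module ℝ M] [OBimodule M]

theorem involution_triple {A : Type*} [Ring A] {a b c : A} (ha : a * a = 1) (hb : b * b = 1)
    (hab : a * b = -c) (hba : b * a = -c) :
    a * b = -c ∧ b * a = -c ∧ a * c = -b ∧ c * a = -b ∧ b * c = -a ∧ c * b = -a := by
  have hc : c = -(a * b) := by rw [hab, neg_neg]
  have hc' : c = -(b * a) := by rw [hba, neg_neg]
  refine ⟨hab, hba, ?_, ?_, ?_, ?_⟩
  · rw [hc, mul_neg, ← mul_assoc, ha, one_mul]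
  · rw [hc', neg_mul, mul_assoc, ha, mul_one]
  · rw [hc', mul_neg, ← mul_assoc, hb, one_mul]
  · rw [hc, neg_mul, mul_assoc, hb, mul_one]

/-- Every triple operator is `-1` on the range of `1 - ∑ lineOp`. -/
theorem lineOp_mul_one_sub_sum (t : Fin 7) :
    lineOp M t * (1 - ∑ s, lineOp M s) = -(1 - ∑ s, lineOp M s) := by
  -- Cyclic rotations of each line make any of its three points the last factor, the place of the
  -- common point in `line_mul_line`.
  have v0 : lineFst 0 = 1 ∧ lineSnd 0 = 2 ∧ lineTrd 0 = 3 := by decide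
  have m0 := e_mul_line 0
  have r00 : lE M 1 * lE M 2 * lE M 3 = lineOp M 0 := by
    rw [lineOp, v0.1, v0.2.1, v0.2.2]
  have r01 : lE M 2 * lE M 3 * lE M 1 = lineOp M 0 := by
    rw [← r00]
    exact lE_rotate (by decide) (by decide) (by decide) (by decide) (by decide)
  have r02 : lE M 3 * lE M 1 * lE M 2 = lineOp M 0 := by
    rw [← r01]
    exact lE_rotate (by decide) (by decide) (by decide) (by decide) (by decide)
  rw [v0.1, v0.2.1, v0.2.2] at m0
  have v1 : lineFst 1 = 1 ∧ lineSnd 1 = 4 ∧ lineTrd 1 = 5 := by decide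
  have m1 := e_mul_line 1
  have r10 : lE M 1 * lE M 4 * lE M 5 = lineOp M 1 := by
    rw [lineOp, v1.1, v1.2.1, v1.2.2]
  have r11 : lE M 4 * lE M 5 * lE M 1 = lineOp M 1 := by
    rw [← r10]
    exact lE_rotate (by decide) (by decide) (by decide) (by decide) (by decide)
  have r12 : lE M 5 * lE M 1 * lE M 4 = lineOp M 1 := by
    rw [← r11]
    exact lE_rotate (by decide) (by decide) (by decide) (by decide) (by decide)
  rw [v1.1, v1.2.1, v1.2.2] at m1
  have v2 : lineFst 2 = 1 ∧ lineSnd 2 = 7 ∧ lineTrd 2 = 6 := by decide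
  have m2 := e_mul_line 2
  have r20 : lE M 1 * lE M 7 * lE M 6 = lineOp M 2 := by
    rw [lineOp, v2.1, v2.2.1, v2.2.2]
  have r21 : lE M 7 * lE M 6 * lE M 1 = lineOp M 2 := by
    rw [← r20]
    exact lE_rotate (by decide) (by decide) (by decide) (by decide) (by decide)
  have r22 : lE M 6 * lE M 1 * lE M 7 = lineOp M 2 := by
    rw [← r21]
    exact lE_rotate (by decide) (by decide) (by decide) (by decide) (by decide)
  rw [v2.1, v2.2.1, v2.2.2] at m2
  have v3 : lineFst 3 = 2 ∧ lineSnd 3 = 4 ∧ lineTrd 3 = 6 := by decide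
  have m3 := e_mul_line 3
  have r30 : lE M 2 * lE M 4 * lE M 6 = lineOp M 3 := by
    rw [lineOp, v3.1, v3.2.1, v3.2.2]
  have r31 : lE M 4 * lE M 6 * lE M 2 = lineOp M 3 := by
    rw [← r30]
    exact lE_rotate (by decide) (by decide) (by decide) (by decide) (by decide)
  have r32 : lE M 6 * lE M 2 * lE M 4 = lineOp M 3 := by
    rw [← r31]
    exact lE_rotate (by decide) (by decide) (by decide) (by decide) (by decide)
  rw [v3.1, v3.2.1, v3.2.2] at m3
  have v4 : lineFst 4 = 2 ∧ lineSnd 4 = 5 ∧ lineTrd 4 = 7 := by decide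
  have m4 := e_mul_line 4
  have r40 : lE M 2 * lE M 5 * lE M 7 = lineOp M 4 := by
    rw [lineOp, v4.1, v4.2.1, v4.2.2]
  have r41 : lE M 5 * lE M 7 * lE M 2 = lineOp M 4 := by
    rw [← r40]
    exact lE_rotate (by decide) (by decide) (by decide) (by decide) (by decide)
  have r42 : lE M 7 * lE M 2 * lE M 5 = lineOp M 4 := by
    rw [← r41]
    exact lE_rotate (by decide) (by decide) (by decide) (by decide) (by decide)
  rw [v4.1, v4.2.1, v4.2.2] at m4
  have v5 : lineFst 5 = 3 ∧ lineSnd 5 = 4 ∧ lineTrd 5 = 7 := by decide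
  have m5 := e_mul_line 5
  have r50 : lE M 3 * lE M 4 * lE M 7 = lineOp M 5 := by
    rw [lineOp, v5.1, v5.2.1, v5.2.2]
  have r51 : lE M 4 * lE M 7 * lE M 3 = lineOp M 5 := by
    rw [← r50]
    exact lE_rotate (by decide) (by decide) (by decide) (by decide) (by decide)
  have r52 : lE M 7 * lE M 3 * lE M 4 = lineOp M 5 := by
    rw [← r51]
    exact lE_rotate (by decide) (by decide) (by decide) (by decide) (by decide)
  rw [v5.1, v5.2.1, v5.2.2] at m5
  have v6 : lineFst 6 = 3 ∧ lineSnd 6 = 6 ∧ lineTrd 6 = 5 := by decide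
  have m6 := e_mul_line 6
  have r60 : lE M 3 * lE M 6 * lE M 5 = lineOp M 6 := by
    rw [lineOp, v6.1, v6.2.1, v6.2.2]
  have r61 : lE M 6 * lE M 5 * lE M 3 = lineOp M 6 := by
    rw [← r60]
    exact lE_rotate (by decide) (by decide) (by decide) (by decide) (by decide)
  have r62 : lE M 5 * lE M 3 * lE M 6 = lineOp M 6 := by
    rw [← r61]
    exact lE_rotate (by decide) (by decide) (by decide) (by decide) (by decide)
  rw [v6.1, v6.2.1, v6.2.2] at m6
  -- One block for each Fano point, with the three lines through it. Any two lines meet, so the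
  -- seven blocks contain all products of distinct triple operators.
  obtain ⟨p11, p12, p13, p14, p15, p16⟩ := involution_triple
    (lineOp_mul_self (M := M) 0) (lineOp_mul_self 1) (c := lineOp M 2)
    (by
      have q := line_mul_line (M := M) (by decide) m0.2.1 m1.2.1 m2.2.1 m0.1
      rwa [r01, r11, r21] at q)
    (by
      have q := line_mul_line (M := M) (by decide) m1.2.1 m0.2.1 m2.2.1 m1.1
      rwa [r11, r01, r21] at q)
  obtain ⟨p21, p22, p23, p24, p25, p26⟩ := involution_triple
    (lineOp_mul_self (M := M) 0) (lineOp_mul_self 3) (c := lineOp M 4)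
    (by
      have q := line_mul_line (M := M) (by decide) m0.2.2 m3.2.1 m4.2.1 m0.2.1
      rwa [r02, r31, r41] at q)
    (by
      have q := line_mul_line (M := M) (by decide) m3.2.1 m0.2.2 m4.2.1 m3.1
      rwa [r31, r02, r41] at q)
  obtain ⟨p31, p32, p33, p34, p35, p36⟩ := involution_triple
    (lineOp_mul_self (M := M) 0) (lineOp_mul_self 5) (c := lineOp M 6)
    (by
      have q := line_mul_line (M := M) (by decide) m0.1 m5.2.1 m6.2.1 m0.2.2
      rwa [r00, r51, r61] at q)
    (by
      have q := line_mul_line (M := M) (by decide) m5.2.1 m0.1 m6.2.1 m5.1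
      rwa [r51, r00, r61] at q)
  obtain ⟨p41, p42, p43, p44, p45, p46⟩ := involution_triple
    (lineOp_mul_self (M := M) 1) (lineOp_mul_self 3) (c := lineOp M 5)
    (by
      have q := line_mul_line (M := M) (by decide) m1.2.2 m3.2.2 m5.2.2 m1.2.1
      rwa [r12, r32, r52] at q)
    (by
      have q := line_mul_line (M := M) (by decide) m3.2.2 m1.2.2 m5.2.2 m3.2.1
      rwa [r32, r12, r52] at q)
  obtain ⟨p51, p52, p53, p54, p55, p56⟩ := involution_triple
    (lineOp_mul_self (M := M) 1) (lineOp_mul_self 4) (c := lineOp M 6)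
    (by
      have q := line_mul_line (M := M) (by decide) m1.1 m4.2.2 m6.1 m1.2.2
      rwa [r10, r42, r60] at q)
    (by
      have q := line_mul_line (M := M) (by decide) m4.2.2 m1.1 m6.1 m4.2.1
      rwa [r42, r10, r60] at q)
  obtain ⟨p61, p62, p63, p64, p65, p66⟩ := involution_triple
    (lineOp_mul_self (M := M) 2) (lineOp_mul_self 3) (c := lineOp M 6)
    (by
      have q := line_mul_line (M := M) (by decide) m2.1 m3.1 m6.2.2 m2.2.2
      rwa [r20, r30, r62] at q)
    (by
      have q := line_mul_line (M := M) (by decide) m3.1 m2.1 m6.2.2 m3.2.2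
      rwa [r30, r20, r62] at q)
  obtain ⟨p71, p72, p73, p74, p75, p76⟩ := involution_triple
    (lineOp_mul_self (M := M) 2) (lineOp_mul_self 4) (c := lineOp M 5)
    (by
      have q := line_mul_line (M := M) (by decide) m2.2.2 m4.1 m5.1 m2.2.1
      rwa [r22, r40, r50] at q)
    (by
      have q := line_mul_line (M := M) (by decide) m4.1 m2.2.2 m5.1 m4.2.2
      rwa [r40, r22, r50] at q)
  have sq (t : Fin 7) := lineOp_mul_self (M := M) t
  -- The operators `1` and `-lineOp M s` multiply as in `(ℤ/2)³`, and `1 - ∑ lineOp` is their sum;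
  -- multiplication by `-lineOp M t` only permutes the summands.
  simp only [Fin.sum_univ_seven]
  fin_cases t <;> simp only [Fin.zero_eta, Fin.mk_one, Fin.reduceFinMk, mul_sub, mul_add, mul_one,
    sq, p11, p12, p13, p14, p15, p16, p21, p22, p23, p24, p25, p26, p31, p32, p33, p34, p35,
    p36, p41, p42, p43, p44, p45, p46, p51, p52, p53, p54, p55, p56, p61, p62, p63, p64, p65,
    p66, p71, p72, p73, p74, p75, p76] <;> abel

end OBimodule

/-! ### Real elements span the bimodule -/

namespace OBimodule

open Octonion

variable {M : Type*} [AddCommGroup M] [Module ℝ M] [OBimodule M]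

theorem lsmul_mul_of_basis {m : M}
    (h : ∀ i j, lsmul (e i * e j) m = lsmul (e i) (lsmul (e j) m)) (p q : Octonion) :
    lsmul (p * q) m = lsmul p (lsmul q m) := by
  rw [eq_sum_apply p, eq_sum_apply q]
  simp only [Finset.sum_mul, Finset.mul_sum, map_sum, LinearMap.sum_apply, smul_mul_assoc,
    mul_smul_comm, map_smul, LinearMap.smul_apply, h]

/-- A common eigenvector of the triple operators for the eigenvalue `-1` is real. -/
theorem mem_realPart_of_lineOp {m : M} (h : ∀ t, lineOp M t m = -m) : m ∈ realPart M := by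
  have line (i j k : Fin 8) (hi : i ≠ 0) (hj : j ≠ 0) (hij : i ≠ j)
      (hk : k ≠ 0) (hm : e i * e j = e k) (hL : lE M k (lE M i (lE M j m)) = -m) :
      lsmul (e i * e j) m = lsmul (e i) (lsmul (e j) m) ∧
      lsmul (e j * e i) m = lsmul (e j) (lsmul (e i) m) := by
    -- Applying `L_k` to `L_k L_i L_j m = -m` gives `e_k m = e_i (e_j m)`, which is associativity
    -- since `e_k = e_i e_j`.
    have h1 : lE M k m = lE M i (lE M j m) := by
      have h2 := congrArg (lE M k) hL
      have h3 : lE M k (lE M k (lE M i (lE M j m))) = -(lE M i (lE M j m)) :=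
        LinearMap.congr_fun (lE_mul_self (M := M) hk) _
      rw [h3, map_neg] at h2
      exact (neg_injective h2).symm
    have h2 : lE M j (lE M i m) = -(lE M i (lE M j m)) :=
      LinearMap.congr_fun (lE_anticomm (M := M) hi hj hij) m
    simp only [lE_apply] at h1 h2
    refine ⟨by rw [hm, h1], ?_⟩
    rw [neg_mul_of_ne hi hj hij, hm, map_neg, LinearMap.neg_apply, h1, h2]
  intro p q
  rw [sub_eq_zero]
  refine lsmul_mul_of_basis (fun i j => ?_) p q
  rcases exists_line i j with rfl | rfl | rfl | ⟨t, ht⟩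
  · rw [e_zero, one_mul, one_lsmul]
  · rw [e_zero, mul_one, one_lsmul]
  · rw [lsmul_lsmul_self]
  · obtain ⟨h1, h2, h3, h12, h13, h23⟩ := line_ne t
    obtain ⟨m1, m2, m3⟩ := e_mul_line t
    have c0 : lE M (lineFst t) (lE M (lineSnd t) (lE M (lineTrd t) m)) = -m := h t
    have c1 : lE M (lineSnd t) (lE M (lineTrd t) (lE M (lineFst t) m)) = -m :=
      (LinearMap.congr_fun (lE_rotate (M := M) h1 h2 h3 h12 h13) m).trans c0
    have c2 : lE M (lineTrd t) (lE M (lineFst t) (lE M (lineSnd t) m)) = -m :=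
      (LinearMap.congr_fun (lE_rotate (M := M) h2 h3 h1 h23 h12.symm) m).trans c1
    rcases ht with ⟨rfl, rfl⟩ | ⟨rfl, rfl⟩ | ⟨rfl, rfl⟩ | ⟨rfl, rfl⟩ | ⟨rfl, rfl⟩ | ⟨rfl, rfl⟩
    · exact (line _ _ _ h1 h2 h12 h3 m1 c2).1
    · exact (line _ _ _ h2 h3 h23 h1 m2 c0).1
    · exact (line _ _ _ h3 h1 h13.symm h2 m3 c1).1
    · exact (line _ _ _ h1 h2 h12 h3 m1 c2).2
    · exact (line _ _ _ h2 h3 h23 h1 m2 c0).2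
    · exact (line _ _ _ h3 h1 h13.symm h2 m3 c1).2

theorem one_sub_sum_lineOp_mem (m : M) : (1 - ∑ t, lineOp M t) m ∈ realPart M :=
  mem_realPart_of_lineOp fun t => LinearMap.congr_fun (lineOp_mul_one_sub_sum (M := M) t) m

/-- A unit on the line commutes with the triple product, since it anticommutes with exactly two
factors; a unit off the line anticommutes with all three. The square `-1` then fixes the sign. -/
theorem lE_mul_lineOp_mul_lE (i : Fin 8) (hi : i ≠ 0) (t : Fin 7) :
    lE M i * lineOp M t * lE M i =
      if i = lineFst t ∨ i = lineSnd t ∨ i = lineTrd t then -lineOp M t else lineOp M t := by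
  have h (i j : Fin 8) (hi : i ≠ 0) (hj : j ≠ 0) (hij : i ≠ j) (x : Module.End ℝ M) :
      lE M j * (lE M i * x) = -(lE M i * (lE M j * x)) := by
    rw [← mul_assoc, lE_anticomm hi hj hij, neg_mul, mul_assoc]
  have h' (i : Fin 8) (hi : i ≠ 0) (x : Module.End ℝ M) : lE M i * (lE M i * x) = -x := by
    rw [← mul_assoc, lE_mul_self hi, neg_one_mul]
  obtain ⟨h1, h2, h3, h12, h13, h23⟩ := line_ne t
  simp only [lineOp, mul_assoc]
  split_ifs with hit
  · rcases hit with rfl | rfl | rfl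
    · rw [h' _ h1, lE_anticomm h1 h3 h13, mul_neg, h _ _ h1 h2 h12, neg_neg]
    · simp only [lE_anticomm h2 h3 h23, mul_neg, h' _ h2, h _ _ h1 h2 h12, neg_neg]
    · simp only [lE_mul_self h3, mul_neg, mul_one, h _ _ h1 h3 h13, lE_anticomm h2 h3 h23,
        neg_neg]
  · push Not at hit
    obtain ⟨n1, n2, n3⟩ := hit
    simp only [lE_anticomm hi h3 n3, mul_neg, h _ _ hi h2 n2, h _ _ hi h1 n1, h' _ hi, neg_neg]

theorem sum_lE_mul_lineOp_mul_lE (t : Fin 7) :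
    ∑ i : Fin 7, lE M i.succ * lineOp M t * lE M i.succ = lineOp M t := by
  rw [Finset.sum_congr rfl fun i _ => lE_mul_lineOp_mul_lE i.succ (Fin.succ_ne_zero i) t]
  rw [Finset.sum_ite, Finset.sum_const, Finset.sum_const]
  -- Three units lie on the line and four off it: `4 - 3 = 1`.
  have h : (Finset.univ.filter fun i : Fin 7 =>
      i.succ = lineFst t ∨ i.succ = lineSnd t ∨ i.succ = lineTrd t).card = 3 ∧
      (Finset.univ.filter fun i : Fin 7 =>
      ¬ (i.succ = lineFst t ∨ i.succ = lineSnd t ∨ i.succ = lineTrd t)).card = 4 := by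
    revert t; decide
  rw [h.1, h.2]
  abel

/-- Every element of a bimodule is an octonionic combination of real elements. -/
theorem exists_eq_sum_lsmul (m : M) :
    ∃ u : Fin 8 → M, (∀ i, u i ∈ realPart M) ∧ m = ∑ i, lsmul (e i) (u i) := by
  set E : Module.End ℝ M := 1 - ∑ t, lineOp M t with hE
  -- The term `1` of `E` contributes `1 + 7`, and the triple operators cancel by
  -- `sum_lE_mul_lineOp_mul_lE`. As `E` takes real values, this exhibits `8 m` as a combination of
  -- real elements.
  have key : E - ∑ i : Fin 7, lE M i.succ * E * lE M i.succ = (8 : ℝ) • 1 := by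
    have h1 : ∀ i : Fin 7, lE M i.succ * E * lE M i.succ
        = -1 - ∑ t, lE M i.succ * lineOp M t * lE M i.succ := fun i => by
      rw [hE, mul_sub, sub_mul, mul_one, lE_mul_self (Fin.succ_ne_zero i), Finset.mul_sum,
        Finset.sum_mul]
    simp only [h1, Finset.sum_sub_distrib, Finset.sum_const, Finset.card_univ, Fintype.card_fin]
    rw [Finset.sum_comm, Finset.sum_congr rfl fun t _ => sum_lE_mul_lineOp_mul_lE (M := M) t, hE]
    module
  refine ⟨Fin.cons ((1 / 8 : ℝ) • E m) fun i => -((1 / 8 : ℝ) • E (lE M i.succ m)), ?_, ?_⟩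
  · refine Fin.cases ?_ fun i => ?_
    · exact Submodule.smul_mem _ _ (one_sub_sum_lineOp_mem m)
    · exact Submodule.neg_mem _ (Submodule.smul_mem _ _ (one_sub_sum_lineOp_mem _))
  · have h := LinearMap.congr_fun key m
    simp only [LinearMap.sub_apply, LinearMap.sum_apply, Module.End.mul_apply,
      LinearMap.smul_apply, Module.End.one_apply] at h
    have h2 : m = (1 / 8 : ℝ) • (8 : ℝ) • m := by module
    rw [Fin.sum_univ_succ]
    simp only [Fin.cons_zero, Fin.cons_succ, e_zero, one_lsmul, map_neg, map_smul,
      Finset.sum_neg_distrib, ← Finset.smul_sum, ← sub_eq_add_neg, ← smul_sub]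
    conv_lhs => rw [h2, ← h]
    rfl

/-! ### Calculus with real elements and para-linear maps -/

theorem lsmul_lsmul_of_mem {n : M} (hn : n ∈ realPart M) (p q : Octonion) :
    lsmul p (lsmul q n) = lsmul (p * q) n :=
  (sub_eq_zero.mp (hn p q)).symm

theorem rsmul_rsmul_of_mem {n : M} (hn : n ∈ realPart M) (p q : Octonion) :
    rsmul (rsmul n p) q = rsmul n (p * q) :=
  sub_eq_zero.mp ((left_eq_right n p q).symm.trans (hn p q))

theorem rsmul_lsmul_of_mem {n : M} (hn : n ∈ realPart M) (p q : Octonion) :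
    rsmul (lsmul q n) p = lsmul q (rsmul n p) :=
  sub_eq_zero.mp ((left_eq_middle n p q).symm.trans (hn p q))

/-- The associator identities for `x n` and for `n y` share the term `(x (n y)) z`; eliminating it
moves the octonion associator from the left of `n` to the right. Associators reach every imaginary
unit, hence commutation. -/
theorem lsmul_associator_of_mem {n : M} (hn : n ∈ realPart M) (x y z : Octonion) :
    lsmul (y * z * x - y * (z * x)) n = rsmul n (y * z * x - y * (z * x)) := by
  have h1 := left_eq_right (lsmul x n) y z
  have h2 := middle_eq_right (rsmul n y) z x
  rw [lsmul_lsmul_of_mem hn, lsmul_lsmul_of_mem hn, lsmul_lsmul_of_mem hn,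
    rsmul_lsmul_of_mem hn, rsmul_lsmul_of_mem hn] at h1
  rw [rsmul_rsmul_of_mem hn, rsmul_rsmul_of_mem hn, rsmul_rsmul_of_mem hn] at h2
  rw [map_sub, LinearMap.sub_apply, map_sub, h1, h2]

/-- Real elements commute with the octonions. -/
theorem lsmul_eq_rsmul_of_mem {n : M} (hn : n ∈ realPart M) (p : Octonion) :
    lsmul p n = rsmul n p := by
  have h (i : Fin 8) : lsmul (e i) n = rsmul n (e i) := by
    by_cases hi : i = 0
    · rw [hi, e_zero, one_lsmul, rsmul_one]
    · obtain ⟨y, z, x, h⟩ := exists_e_eq_associator i hi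
      rw [h, lsmul_associator_of_mem hn]
  rw [eq_sum_apply p]
  simp only [map_sum, LinearMap.sum_apply, map_smul, LinearMap.smul_apply, h]

theorem reProj_rsmul_of_mem {n : M} (hn : n ∈ realPart M) (q : Octonion) :
    reProj (rsmul n q) = q.re • n := by
  -- For `q = 1` the sum is `-7`; for an imaginary unit it is `(6 - 1) q = 5 q`. This explains the
  -- constants `5/12` and `1/12`.
  have h : (5 / 12 : ℝ) • q - (1 / 12 : ℝ) • ∑ i : Fin 7, e i.succ * q * e i.succ
      = q.re • (1 : Octonion) := by
    rw [Fin.sum_univ_seven]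
    apply ext_coords <;> simp [mul_apply_zero, mul_apply_one, mul_apply_two,
      mul_apply_three, mul_apply_four, mul_apply_five, mul_apply_six, mul_apply_seven,
      e_apply, sub_apply, add_apply, smul_apply, one_apply, re] <;> ring
  rw [reProj]
  have h2 (i : Fin 7) : rsmul (lsmul (e i.succ) (rsmul n q)) (e i.succ)
      = rsmul n (e i.succ * q * e i.succ) := by
    rw [← rsmul_lsmul_of_mem hn, lsmul_eq_rsmul_of_mem hn, rsmul_rsmul_of_mem hn,
      rsmul_rsmul_of_mem hn]
  simp only [h2]
  rw [← map_sum, ← map_smul, ← map_smul, ← map_sub, h, map_smul, rsmul_one]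

theorem exists_eq_sum_rsmul (m : M) :
    ∃ u : Fin 8 → M, (∀ i, u i ∈ realPart M) ∧ m = ∑ i, rsmul (u i) (e i) := by
  obtain ⟨u, hu, h⟩ := exists_eq_sum_lsmul m
  exact ⟨u, hu, h.trans (Finset.sum_congr rfl fun i _ => lsmul_eq_rsmul_of_mem (hu i) _)⟩

/-- The projection onto the real part as a linear map. -/
noncomputable def reLin : M →ₗ[ℝ] M where
  toFun := reProj
  map_add' x y := by
    simp only [reProj, map_add, LinearMap.add_apply, Finset.sum_add_distrib, smul_add]
    abel
  map_smul' c x := by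
    simp only [reProj, map_smul, LinearMap.smul_apply, ← Finset.smul_sum, RingHom.id_apply]
    module

theorem reLin_apply (m : M) : reLin m = reProj m := rfl

theorem reProj_mem (m : M) : reProj m ∈ realPart M := by
  obtain ⟨u, hu, rfl⟩ := exists_eq_sum_rsmul m
  rw [← reLin_apply, map_sum]
  refine Submodule.sum_mem _ fun i _ => ?_
  rw [reLin_apply, reProj_rsmul_of_mem (hu i)]
  exact Submodule.smul_mem _ _ (hu i)

theorem reProj_rsmul_rsmul (m : M) (p q : Octonion) :
    reProj (rsmul (rsmul m p) q) = reProj (rsmul m (p * q)) := by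
  obtain ⟨u, hu, rfl⟩ := exists_eq_sum_rsmul m
  simp only [← reLin_apply, map_sum, LinearMap.sum_apply]
  refine Finset.sum_congr rfl fun i _ => ?_
  rw [rsmul_rsmul_of_mem (hu i), rsmul_rsmul_of_mem (hu i), rsmul_rsmul_of_mem (hu i),
    reLin_apply, reLin_apply, reProj_rsmul_of_mem (hu i), reProj_rsmul_of_mem (hu i), re_mul_assoc]

theorem eq_sum_reProj (m : M) : m = ∑ i, rsmul (reProj (rsmul m (e i).conj)) (e i) := by
  obtain ⟨u, hu, h⟩ := exists_eq_sum_rsmul m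
  have h1 (i : Fin 8) : reProj (rsmul m (e i).conj) = u i := by
    rw [h, ← reLin_apply]
    simp only [map_sum, LinearMap.sum_apply]
    have h2 (j : Fin 8) : reLin (rsmul (rsmul (u j) (e j)) (e i).conj)
        = (if i = j then (1 : ℝ) else 0) • u j := by
      rw [rsmul_rsmul_of_mem (hu j), reLin_apply, reProj_rsmul_of_mem (hu j), re_smul_mul_conj]
      congr 1
      simp [e_apply, eq_comm]
    simp [h2]
  simp only [h1]
  exact h

theorem ext_reProj {m m' : M} (h : ∀ p, reProj (rsmul m p) = reProj (rsmul m' p)) : m = m' := by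
  rw [eq_sum_reProj m, eq_sum_reProj m']
  simp only [h]

/-- A para-linear map commutes with right multiplication by `p` at elements that associate
with `p`. -/
theorem IsParaLinear.map_rsmul {f : M →ₗ[ℝ] M} (hf : IsParaLinear f) {x : M} {p : Octonion}
    (hx : ∀ q, rsmul (rsmul x p) q = rsmul x (p * q)) : f (rsmul x p) = rsmul (f x) p := by
  have h (x : M) (p : Octonion) : reProj (rsmul (f x) p) = reProj (f (rsmul x p)) := by
    have := hf p x
    rwa [← reLin_apply, map_sub, sub_eq_zero] at this
  refine ext_reProj fun q => ?_
  -- `Re (f (x p) q) = Re f ((x p) q) = Re f (x (p q)) = Re (f x (p q)) = Re ((f x p) q)`.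
  rw [h, hx, ← h, reProj_rsmul_rsmul]

theorem reProj_mem_of_isOSubmodule {N : Submodule ℝ M} (hN : IsOSubmodule N) {m : M} (hm : m ∈ N) :
    reProj m ∈ N :=
  N.sub_mem (N.smul_mem _ hm) (N.smul_mem _ (N.sum_mem fun _ _ => (hN _ _ (hN _ _ hm).1).2))

end OBimodule

/-! ### The octonion-valued form on real elements and on the slice cone -/

namespace PreHilbertOBimodule

open Octonion OBimodule

variable {H : Type*} [NormedAddCommGroup H] [NormedSpace ℝ H] [PreHilbertOBimodule H]

theorem re_oinner_rsmul (u v : H) (p : Octonion) :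
    (oinner u (rsmul v p)).re = (oinner u v * p).re := by
  have := oinner_paraLinear u v p
  rw [re_sub] at this
  linarith

theorem oinner_rsmul {v : H} {p : Octonion}
    (hv : ∀ q, rsmul (rsmul v p) q = rsmul v (p * q)) (u : H) :
    oinner u (rsmul v p) = oinner u v * p :=
  ext_re_mul fun q => by rw [← re_oinner_rsmul, hv, re_oinner_rsmul, re_mul_assoc]

theorem oinner_rsmul_of_mem {v : H} (hv : v ∈ realPart H) (u : H) (p : Octonion) :
    oinner u (rsmul v p) = oinner u v * p :=
  oinner_rsmul (rsmul_rsmul_of_mem hv p) u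

theorem rsmul_oinner_of_mem {v : H} (hv : v ∈ realPart H) (u : H) (p : Octonion) :
    oinner (rsmul v p) u = p.conj * oinner v u := by
  rw [oinner_conj, oinner_rsmul_of_mem hv, conj_mul, ← oinner_conj]

/-- Evaluating `⟨x q̄, y p⟩` by its two slots in either order gives `(q c) p = q (c p)` for `c = ⟨x,
y⟩`, so `c` is in the nucleus. -/
theorem oinner_of_mem {x y : H} (hx : x ∈ realPart H) (hy : y ∈ realPart H) :
    oinner x y = (oinner x y).re • (1 : Octonion) := by
  rw [← ofReal_eq_smul]
  refine eq_ofReal_of_middle_assoc fun p q => ?_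
  have h1 : oinner (rsmul x q.conj) (rsmul y p) = q * oinner x y * p := by
    rw [oinner_rsmul_of_mem hy, rsmul_oinner_of_mem hx, conj_conj]
  have h2 : oinner (rsmul x q.conj) (rsmul y p) = q * (oinner x y * p) := by
    rw [rsmul_oinner_of_mem hx, oinner_rsmul_of_mem hy, conj_conj]
  exact h1.symm.trans h2

theorem oinner_rsmul_rsmul_of_mem {x y : H} (hx : x ∈ realPart H) (hy : y ∈ realPart H)
    (p q : Octonion) :
    oinner (rsmul x p) (rsmul y q) = (oinner x y).re • (p.conj * q) := by
  conv_lhs => rw [oinner_rsmul_of_mem hy, rsmul_oinner_of_mem hx, oinner_of_mem hx hy]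
  rw [mul_smul_comm, mul_one, smul_mul_assoc]

/-- A submodule is spanned by its own real part, and the form is real between real elements, so real
orthogonality there suffices. -/
theorem oinner_eq_zero_of_mem_isOSubmodule {N : Submodule ℝ H} (hN : IsOSubmodule N) {v : H}
    (hv : v ∈ realPart H) (hvN : ∀ u ∈ N ⊓ realPart H, (oinner v u).re = 0) {y : H} (hy : y ∈ N) :
    oinner v y = 0 := by
  rw [eq_sum_reProj y, map_sum]
  refine Finset.sum_eq_zero fun i _ => ?_
  have hm := reProj_mem (rsmul y (e i).conj)
  rw [oinner_rsmul_of_mem hm, oinner_of_mem hv hm,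
    hvN _ ⟨reProj_mem_of_isOSubmodule hN (hN _ _ hy).2, hm⟩, zero_smul, zero_mul]

theorem exists_oinner_eq_of_mem_sliceCone {z : H} (hz : z ∈ sliceCone H) :
    ∃ J ∈ imSphere, (∀ v ∈ realPart H, ∃ α γ : ℝ, oinner z v = α • (1 : Octonion) + γ • J) ∧
      ∀ (α γ : ℝ) (q : Octonion),
        rsmul (rsmul z (α • (1 : Octonion) + γ • J)) q
          = rsmul z ((α • (1 : Octonion) + γ • J) * q) := by
  obtain ⟨J, hJ, x, hx, y, hy, rfl⟩ := hz
  refine ⟨J, hJ, fun v hv => ⟨(oinner x v).re, -(oinner y v).re, ?_⟩, fun α γ q => ?_⟩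
  · rw [lsmul_eq_rsmul_of_mem hy, map_add, LinearMap.add_apply, rsmul_oinner_of_mem hy,
      conj_of_mem_imSphere hJ]
    conv_lhs => rw [oinner_of_mem hx hv, oinner_of_mem hy hv]
    rw [neg_mul, mul_smul_comm, mul_one, neg_smul]
  · have h (p : Octonion) : rsmul (x + lsmul J y) p = rsmul x p + rsmul y (J * p) := by
      rw [lsmul_eq_rsmul_of_mem hy, map_add, LinearMap.add_apply, rsmul_rsmul_of_mem hy]
    rw [h, h, map_add, LinearMap.add_apply, rsmul_rsmul_of_mem hx, rsmul_rsmul_of_mem hy]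
    congr 2
    simp only [mul_add, add_mul, mul_smul_comm, smul_mul_assoc, mul_one, one_mul,
      mul_mul_self_left]

/-- An element of the slice cone associates with its products with real elements. -/
theorem rsmul_rsmul_oinner {z v : H} (hz : z ∈ sliceCone H) (hv : v ∈ realPart H) (q : Octonion) :
    rsmul (rsmul z (oinner z v)) q = rsmul z (oinner z v * q) := by
  obtain ⟨J, -, h1, h2⟩ := exists_oinner_eq_of_mem_sliceCone hz
  obtain ⟨α, γ, h⟩ := h1 v hv
  rw [h, h2]

/-- Of the four terms of the expansion, only the one with both `J` and `K` depends on bracketing; it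
produces the associator correction. -/
theorem re_oinner_rsmul_rsmul {x y a b : H} (hx : x ∈ realPart H) (hy : y ∈ realPart H)
    (ha : a ∈ realPart H) (hb : b ∈ realPart H) {J K : Octonion} (hJ : J ∈ imSphere)
    (p q : Octonion) :
    (oinner (rsmul (x + lsmul J y) p) (rsmul (a + lsmul K b) q)).re
      = (p.conj * (oinner (x + lsmul J y) (a + lsmul K b) * q)).re
        + (p.conj * ((oinner y b).re • (J * K * q - J * (K * q)))).re := by
  rw [lsmul_eq_rsmul_of_mem hy, lsmul_eq_rsmul_of_mem hb, ← rsmul_one x, ← rsmul_one a]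
  simp only [map_add, LinearMap.add_apply, rsmul_rsmul_of_mem hx, rsmul_rsmul_of_mem hy,
    rsmul_rsmul_of_mem ha, rsmul_rsmul_of_mem hb, oinner_rsmul_rsmul_of_mem, hx, hy, ha, hb,
    conj_mul, conj_of_mem_imSphere hJ, conj_one, one_mul, mul_one, add_mul, mul_add, re_add,
    smul_mul_assoc, mul_smul_comm, re_smul, mul_sub, re_sub, mul_neg, neg_mul]
  have hneg (u : Octonion) : (-u).re = -u.re := rfl
  simp only [hneg, re_mul_assoc]
  ring

theorem oinner_slice {x y a b : H} (hx : x ∈ realPart H) (hy : y ∈ realPart H)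
    (ha : a ∈ realPart H) (hb : b ∈ realPart H) {J K : Octonion} (hJ : J ∈ imSphere) :
    oinner (x + lsmul J y) (a + lsmul K b) = (oinner x a).re • (1 : Octonion)
      + (oinner x b).re • K - (oinner y a).re • J - (oinner y b).re • (J * K) := by
  rw [lsmul_eq_rsmul_of_mem hy, lsmul_eq_rsmul_of_mem hb]
  simp only [map_add, LinearMap.add_apply]
  rw [rsmul_oinner_of_mem hy, rsmul_oinner_of_mem hy, oinner_rsmul_of_mem hb,
    oinner_rsmul_of_mem hb, conj_of_mem_imSphere hJ]
  conv_lhs => rw [oinner_of_mem hx ha, oinner_of_mem hx hb, oinner_of_mem hy ha,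
    oinner_of_mem hy hb]
  simp only [neg_mul, mul_smul_comm, smul_mul_assoc, mul_one, one_mul, smul_neg]
  abel

/-- Orthogonal elements of the slice cone generate orthogonal right spans. -/
theorem re_oinner_rsmul_rsmul_eq_zero {z w : H} (hz : z ∈ sliceCone H) (hw : w ∈ sliceCone H)
    (h : oinner z w = 0) (p q : Octonion) : (oinner (rsmul z p) (rsmul w q)).re = 0 := by
  obtain ⟨J, hJ, x, hx, y, hy, rfl⟩ := hz
  obtain ⟨K, -, a, ha, b, hb, rfl⟩ := hw
  rw [re_oinner_rsmul_rsmul hx hy ha hb hJ, h]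
  rw [oinner_slice hx hy ha hb hJ] at h
  rw [smul_assoc_eq_zero hJ h, zero_mul, mul_zero, re_zero, add_zero]

/-- With `K = J` the correction is an associator `[J, J, q]`, which vanishes by alternativity; for a
unit `z` the `z e_i` are thus orthonormal. -/
theorem re_oinner_rsmul_rsmul_self {z : H} (hz : z ∈ sliceCone H) (p q : Octonion) :
    (oinner (rsmul z p) (rsmul z q)).re = ‖z‖ ^ 2 * ∑ i, p i * q i := by
  have h := oinner_self z
  obtain ⟨J, hJ, x, hx, y, hy, rfl⟩ := hz
  rw [re_oinner_rsmul_rsmul hx hy hx hy hJ, h, mul_mul_self_left, sub_self, smul_zero, mul_zero,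
    re_zero, add_zero, ofReal_eq_smul, smul_mul_assoc, one_mul, mul_smul_comm, re_smul,
    re_mul_comm, re_smul_mul_conj]

/-- The real inner product `Re ⟨u, v⟩`. -/
noncomputable abbrev realInnerProductSpace : InnerProductSpace ℝ H :=
  { (inferInstance : NormedSpace ℝ H) with
    inner := fun u v => (oinner u v).re
    norm_sq_eq_re_inner := fun u => by
      rw [oinner_self]
      simp [re, ofReal_apply]
    conj_inner_symm := fun u v => by
      rw [oinner_conj v u, re_conj]
      rfl
    add_left := fun u v w => by
      rw [map_add, LinearMap.add_apply, re_add]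
    smul_left := fun u v r => by
      rw [map_smul, LinearMap.smul_apply, re_smul]
      rfl }

/-- Each `y ∈ N` is `∑ n_i e_i` with its eight coefficients in `N ∩ Re H`. -/
theorem finrank_le_of_isOSubmodule {N : Submodule ℝ H} (hN : IsOSubmodule N) {n : ℕ}
    (hn : Module.rank ℝ ↥(N ⊓ realPart H) = (n : Cardinal)) :
    FiniteDimensional ℝ N ∧ Module.finrank ℝ N ≤ n * 8 := by
  have hfin : FiniteDimensional ℝ ↥(N ⊓ realPart H) :=
    Module.rank_lt_aleph0_iff.mp (hn ▸ Cardinal.natCast_lt_aleph0)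
  have hfr : Module.finrank ℝ ↥(N ⊓ realPart H) = n := Module.finrank_eq_of_rank_eq hn
  let φ : (Fin 8 → ↥(N ⊓ realPart H)) →ₗ[ℝ] H :=
    ∑ i, (rsmul.flip (e i)) ∘ₗ (N ⊓ realPart H).subtype ∘ₗ LinearMap.proj i
  have hle : N ≤ LinearMap.range φ := fun y hy => by
    refine ⟨fun i => ⟨reProj (rsmul y (e i).conj),
      reProj_mem_of_isOSubmodule hN (hN _ _ hy).2, reProj_mem _⟩, ?_⟩
    simp only [φ, LinearMap.sum_apply, LinearMap.comp_apply, LinearMap.proj_apply,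
      Submodule.subtype_apply, LinearMap.flip_apply]
    exact (eq_sum_reProj y).symm
  refine ⟨Submodule.finiteDimensional_of_le hle, (Submodule.finrank_mono hle).trans ?_⟩
  refine (LinearMap.finrank_range_le φ).trans ?_
  rw [Module.finrank_pi_fintype]
  simp [hfr, mul_comm]

/-- `n` orthonormal elements of the slice cone in a submodule of octonionic dimension `n` form a
basis: the slice projections sum to the identity. -/
theorem eq_sum_rsmul_oinner {N : Submodule ℝ H} (hN : IsOSubmodule N) {n : ℕ}
    (hn : Module.rank ℝ ↥(N ⊓ realPart H) = (n : Cardinal)) {z : Fin n → H}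
    (hz : ∀ k, z k ∈ sliceCone H) (hzN : ∀ k, z k ∈ N) (hunit : ∀ k, ‖z k‖ = 1)
    (horth : ∀ k l, k ≠ l → oinner (z k) (z l) = 0) {v : H} (hv : v ∈ N) :
    v = ∑ k, rsmul (z k) (oinner (z k) v) := by
  let _ : InnerProductSpace ℝ H := realInnerProductSpace
  have inner_eq (u v : H) : inner ℝ u v = (oinner u v).re := rfl
  obtain ⟨hfin, hle⟩ := finrank_le_of_isOSubmodule hN hn
  let w : Fin n × Fin 8 → H := fun k => rsmul (z k.1) (e k.2)
  have hw : Orthonormal ℝ w := by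
    rw [orthonormal_iff_ite]
    rintro ⟨k, i⟩ ⟨l, j⟩
    rw [inner_eq]
    by_cases hkl : k = l
    · subst hkl
      simp only [w]
      rw [re_oinner_rsmul_rsmul_self (hz k), hunit]
      simp [e_apply, Prod.ext_iff, eq_comm]
    · simp only [w]
      rw [re_oinner_rsmul_rsmul_eq_zero (hz k) (hz l) (horth k l hkl), if_neg]
      simp [hkl]
  -- These are `8 n` orthonormal vectors in a space of real dimension at most `8 n`.
  have hspan : Submodule.span ℝ (Set.range w) = N := by
    refine Submodule.eq_of_le_of_finrank_le ?_ ?_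
    · rw [Submodule.span_le]
      rintro _ ⟨k, rfl⟩
      exact (hN _ _ (hzN k.1)).2
    · rw [finrank_span_eq_card hw.linearIndependent]
      simpa using hle
  rw [← hspan, Submodule.mem_span_range_iff_exists_fun] at hv
  obtain ⟨c, hc⟩ := hv
  have hc' (k : Fin n × Fin 8) : c k = (oinner (z k.1) v * (e k.2).conj).re := by
    rw [← hw.inner_right_fintype c k, hc, inner_eq, oinner_conj, re_conj, re_oinner_rsmul,
      ← re_conj, conj_mul, ← oinner_conj, re_mul_comm]
  conv_lhs => rw [← hc, Fintype.sum_prod_type]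
  refine Finset.sum_congr rfl fun k _ => ?_
  conv_rhs => rw [eq_sum (oinner (z k) v), map_sum]
  refine Finset.sum_congr rfl fun i _ => ?_
  rw [map_smul, hc']

/-- Only the `e₀` term of the regular composition has a real part, so `T` is symmetric for the real
inner product. -/
theorem IsSelfAdj.re_oinner {T : H →ₗ[ℝ] H} (hT : IsSelfAdj T) (x y : H) :
    (oinner (T y) x).re = (oinner y (T x)).re := by
  rw [hT x y, regComp, re_sum, Finset.sum_eq_single 0]
  · rw [re_smul, e_zero, conj_one, rsmul_one]
    simp [re, one_apply]
  · intro i _ hi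
    have h : (e i).re = 0 := (e_apply i 0).trans (if_neg hi.symm)
    rw [re_smul, h, mul_zero]
  · simp

end PreHilbertOBimodule

/-! ### The spectral formula -/

open Octonion OBimodule PreHilbertOBimodule in
theorem eq_sum_smul_sliceProj {H : Type*} [NormedAddCommGroup H] [NormedSpace ℝ H]
    [PreHilbertOBimodule H] (T : H →ₗ[ℝ] H) (hpara : IsParaLinear T) (hadj : IsSelfAdj T)
    (n : ℕ) (hrank : HasRank T n) (z : Fin n → H) (lam : Fin n → ℝ) (hlam : ∀ k, lam k ≠ 0)
    (heig : ∀ k, IsStrongEigenpair T (z k) (ofReal (lam k))) (hunit : ∀ k, ‖z k‖ = 1)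
    (horth : ∀ k l, k ≠ l → oinner (z k) (z l) = 0) :
    T = ∑ k, lam k • sliceProj (z k) := by
  obtain ⟨hN, hn⟩ := hrank
  have hz (k : Fin n) : z k ∈ sliceCone H := (heig k).1
  have hTz (k : Fin n) : T (z k) = lam k • z k := by
    rw [(heig k).2.2, ofReal_eq_smul, map_smul, rsmul_one]
  have hzN (k : Fin n) : z k ∈ LinearMap.range T :=
    ⟨(lam k)⁻¹ • z k, by rw [map_smul, hTz, smul_smul, inv_mul_cancel₀ (hlam k), one_smul]⟩
  have happ (x : H) : (∑ k, lam k • sliceProj (z k)) x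
      = ∑ k, lam k • rsmul (z k) (oinner (z k) x) := by
    simp [LinearMap.sum_apply, sliceProj]
  have hrange {v : H} (hv : v ∈ LinearMap.range T ⊓ realPart H) :
      T v = ∑ k, lam k • rsmul (z k) (oinner (z k) v) := by
    conv_lhs => rw [eq_sum_rsmul_oinner hN hn hz hzN hunit horth hv.1, map_sum]
    refine Finset.sum_congr rfl fun k _ => ?_
    rw [hpara.map_rsmul (rsmul_rsmul_oinner (hz k) hv.2), hTz, map_smul, LinearMap.smul_apply]
  have hreal {v : H} (hv : v ∈ realPart H) :
      T v = ∑ k, lam k • rsmul (z k) (oinner (z k) v) := by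
    let _ : InnerProductSpace ℝ H := realInnerProductSpace
    have hfin : FiniteDimensional ℝ ↥(LinearMap.range T ⊓ realPart H) :=
      Module.rank_lt_aleph0_iff.mp (hn ▸ Cardinal.natCast_lt_aleph0)
    -- The split is along `Ran T ∩ Re H`, not `Ran T`, so that both components remain real.
    obtain ⟨v₀, hv₀, v₁, hv₁, rfl⟩ :=
      (LinearMap.range T ⊓ realPart H).exists_add_mem_mem_orthogonal v
    have hv₁r : v₁ ∈ realPart H := by
      have := (realPart H).sub_mem hv hv₀.2
      rwa [add_sub_cancel_left] at this
    have hperp {y : H} (hy : y ∈ LinearMap.range T) : oinner v₁ y = 0 :=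
      oinner_eq_zero_of_mem_isOSubmodule hN hv₁r
        (fun u hu => (Submodule.mem_orthogonal' _ _).mp hv₁ u hu) hy
    have hT : T v₁ = 0 := by
      -- `‖T v₁‖² = Re ⟨v₁, T (T v₁)⟩ = 0`, because `T (T v₁)` lies in `Ran T`.
      have h := hadj.re_oinner (T v₁) v₁
      rw [hperp ⟨_, rfl⟩, oinner_self] at h
      have h' : ‖T v₁‖ ^ 2 = 0 := by simpa [re, ofReal_apply, zero_apply] using h
      simpa using h'
    have h0 (k : Fin n) : oinner (z k) v₁ = 0 := by
      rw [oinner_conj, hperp (hzN k), conj_eq]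
      simp [re_zero]
    rw [map_add, hT, add_zero, hrange hv₀]
    simp [h0]
  ext x
  rw [happ]
  obtain ⟨u, hu, rfl⟩ := exists_eq_sum_rsmul x
  simp only [map_sum, Finset.smul_sum]
  rw [Finset.sum_comm]
  refine Finset.sum_congr rfl fun i _ => ?_
  -- On a real `u`, both `T` and each slice projection commute with right multiplication by `e_i`;
  -- for the latter, `z ⟨z, u e_i⟩ = z (⟨z, u⟩ e_i) = (z ⟨z, u⟩) e_i`.
  rw [hpara.map_rsmul (rsmul_rsmul_of_mem (hu i) _), hreal (hu i), map_sum, LinearMap.sum_apply]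
  refine Finset.sum_congr rfl fun k _ => ?_
  rw [map_smul, LinearMap.smul_apply, rsmul_rsmul_oinner (hz k) (hu i), oinner_rsmul_of_mem (hu i)]

theorem mainTheorem12 {H : Type*} [NormedAddCommGroup H] [NormedSpace ℝ H] [CompleteSpace H]
    [PreHilbertOBimodule H] (T : H →L[ℝ] H)
    (hpara : OBimodule.IsParaLinear (T : H →ₗ[ℝ] H))
    (hadj : PreHilbertOBimodule.IsSelfAdj (T : H →ₗ[ℝ] H))
    (n : ℕ) (hrank : OBimodule.HasRank (T : H →ₗ[ℝ] H) n)
    (z : Fin n → H) (lam : Fin n → ℝ) (hlam : ∀ k, lam k ≠ 0)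
    (heig : ∀ k, OBimodule.IsStrongEigenpair (T : H →ₗ[ℝ] H) (z k) (Octonion.ofReal (lam k)))
    (hunit : ∀ k, ‖z k‖ = 1)
    (horth : ∀ k l, k ≠ l → PreHilbertOBimodule.oinner (z k) (z l) = 0) :
    (T : H →ₗ[ℝ] H) = ∑ k, lam k • PreHilbertOBimodule.sliceProj (z k) := by
  exact eq_sum_smul_sliceProj _ hpara hadj n hrank z lam hlam heig hunit horth
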